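/- Let $C$ be a smooth projective curve over $\mathbb{C}$, let $L$ be a line bundle on $C$, written $L=\mathcal{O}_C(D)$ for a divisor $D$, and let $V\subseteq H^0(C,L)$ be a linear subspace of dimension $3$ (a linear series of rank $2$) that generates $L$, that is, $V\otimes\mathcal{O}_C\to L$ is surjective. Let $\varphi_{|V|}\colon C\to\mathbb{P}^2$, $x\mapsto[s_0(x):s_1(x):s_2(x)]$, be the morphism given by a basis $s_0,s_1,s_2$ of $V$, let $\overline{C}\subset\mathbb{P}^2$ be its image, and assume that $\varphi_{|V|}\colon C\to\overline{C}$ is birational. For a linear series $|W|$ put $\mathrm{rk}|W|=\dim W-1$; the line bundle generated by $W\subseteq H^0(C,L)$ is the image $L'\subseteq L$ of $W\otimes\mathcal{O}_C\to L$. The series $|V|$ is called linearly stable (respectively linearly semistable) if for every subspace $W\subsetneq V$ with $\dim W\ge 2$ the line bundle $L'$ generated by $W$ satisfies $$\frac{\deg L'}{\mathrm{rk}|W|}>\frac{\deg L}{\mathrm{rk}|V|}\qquad\Bigl(\text{respectively } \frac{\deg L'}{\mathrm{rk}|W|}\ge\frac{\deg L}{\mathrm{rk}|V|}\Bigr).$$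 For a (closed) point $p\in\overline{C}$ let $m_p(\overline{C})$ be the multiplicity of the plane curve $\overline{C}$ at $p$, i.e. the largest $m$ such that the ideal of $\overline{C}$ in $\mathcal{O}_{\mathbb{P}^2,p}$ is contained in $\mathfrak{m}_p^m$. Then $|V|$ is linearly stable if and only if $m_p(\overline{C})<\deg L/2$ for all points $p\in\overline{C}$, and $|V|$ is linearly semistable if and only if $m_p(\overline{C})\le\deg L/2$ for all points $p\in\overline{C}$. -/

import Mathlib

open AlgebraicGeometry CategoryTheory

noncomputable section

namespace LinearSeries

/-- A smooth projective curve over `ℂ`: an integral scheme, proper and smooth of relative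
dimension one over `Spec ℂ`. (For such schemes proper and projective are equivalent.) -/
class IsSmoothProjectiveCurve (C : Scheme.{0}) [C.Over (Spec (.of ℂ))] : Prop where
  isIntegral : IsIntegral C
  isProper : IsProper (C ↘ Spec (.of ℂ))
  smooth : SmoothOfRelativeDimension 1 (C ↘ Spec (.of ℂ))

attribute [instance] IsSmoothProjectiveCurve.isIntegral IsSmoothProjectiveCurve.isProper
  IsSmoothProjectiveCurve.smooth

variable (C : Scheme.{0}) [C.Over (Spec (.of ℂ))] [IsSmoothProjectiveCurve C]

instance isLocallyNoetherian_curve : IsLocallyNoetherian C :=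
  LocallyOfFiniteType.isLocallyNoetherian (C ↘ Spec (.of ℂ))

/-- The function field `K(C)` is an extension of `ℂ`, through the structure morphism. -/
instance algebraFunctionField : Algebra ℂ C.functionField :=
  ((C.presheaf.germ ⊤ (genericPoint C) trivial).hom.comp
    ((C ↘ Spec (.of ℂ)).appTop.hom.comp (Scheme.ΓSpecIso (.of ℂ)).inv.hom)).toAlgebra

/-- A divisor on `C`: a finite formal integral combination of closed points. -/
abbrev Divisor : Type := {x : C // IsClosed {x}} →₀ ℤ

variable {C}

/-- The degree of a divisor `D`, which is the degree of the line bundle `𝒪_C(D)`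
(all closed points have residue field `ℂ`). -/
def Divisor.degree (D : Divisor C) : ℤ := D.sum fun _ n => n

/-- The stalk at the closed point `x` of the line bundle `𝒪_C(D)`, as a subset of `K(C)`:
the rational functions `f` with `f = 0` or `ord_x f + D x ≥ 0`. -/
def lineBundleStalk (D : Divisor C) (x : {x : C // IsClosed {x}}) : Set C.functionField :=
  {f | f = 0 ∨ 0 ≤ C.ord f x.1 + D x}

/-- The global sections `H⁰(C, 𝒪_C(D))` of the line bundle `𝒪_C(D)`. -/
def globalSections (D : Divisor C) : Set C.functionField :=
  {f | ∀ x, f ∈ lineBundleStalk D x}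

/-- The space `W` of rational functions generates the line bundle `𝒪_C(D)`: the image of
`W ⊗ 𝒪_C` in the constant sheaf `K(C)` is `𝒪_C(D)`. This is checked on the stalks at the closed
points `x`, where that image is the `𝒪_{C, x}`-submodule of `K(C)` spanned by `W`. -/
def Generates (W : Submodule ℂ C.functionField) (D : Divisor C) : Prop :=
  ∀ x : {x : C // IsClosed {x}},
    (Submodule.span (C.presheaf.stalk x.1) (W : Set C.functionField) : Set C.functionField) =
      lineBundleStalk D x

/-- The rank `dim V - 1` of the linear series `|V|`. -/
def rk (V : Submodule ℂ C.functionField) : ℤ := (Module.finrank ℂ V : ℤ) - 1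

/-- Linear stability of a generating pair `(𝒪_C(D), V)`: for every proper subspace `W` of `V` with
`dim W ≥ 2`, the line bundle `L' = 𝒪_C(D')` generated by `W` satisfies
`deg L' / rk |W| > deg L / rk |V|`. -/
def IsLinearlyStable (D : Divisor C) (V : Submodule ℂ C.functionField) : Prop :=
  ∀ W : Submodule ℂ C.functionField, W < V → 2 ≤ Module.finrank ℂ W →
    ∀ D' : Divisor C, Generates W D' →
      (D'.degree : ℚ) / (rk W : ℚ) > (D.degree : ℚ) / (rk V : ℚ)

/-- Linear semistability of a generating pair `(𝒪_C(D), V)`. -/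
def IsLinearlySemistable (D : Divisor C) (V : Submodule ℂ C.functionField) : Prop :=
  ∀ W : Submodule ℂ C.functionField, W < V → 2 ≤ Module.finrank ℂ W →
    ∀ D' : Divisor C, Generates W D' →
      (D'.degree : ℚ) / (rk W : ℚ) ≥ (D.degree : ℚ) / (rk V : ℚ)

attribute [local instance] MvPolynomial.gradedAlgebra

/-- The projective plane over `ℂ`. -/
abbrev Plane : Scheme.{0} := Proj (MvPolynomial.homogeneousSubmodule (Fin 3) ℂ)

/-- Evaluation of polynomials at a triple of rational functions, with values in
`Γ(Spec K(C), ⊤) = K(C)`. -/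
def evalTriple (s : Fin 3 → C.functionField) :
    MvPolynomial (Fin 3) ℂ →+* Γ(Spec C.functionField, ⊤) :=
  (Scheme.ΓSpecIso C.functionField).inv.hom.comp (MvPolynomial.aeval s).toRingHom

theorem map_irrelevant_evalTriple (s : Fin 3 → C.functionField) (hs : s ≠ 0) :
    (HomogeneousIdeal.irrelevant (MvPolynomial.homogeneousSubmodule (Fin 3) ℂ)).toIdeal.map
      (evalTriple s) = ⊤ := by
  obtain ⟨i, hi⟩ : ∃ i, s i ≠ 0 := by
    by_contra! h
    exact hs (funext h)
  refine Ideal.eq_top_of_isUnit_mem _ (Ideal.mem_map_of_mem _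
    (x := (MvPolynomial.X i : MvPolynomial (Fin 3) ℂ)) ?_) ?_
  · exact HomogeneousIdeal.mem_irrelevant_of_mem _ one_pos (MvPolynomial.isHomogeneous_X ℂ i)
  · have h : IsUnit (MvPolynomial.aeval s (MvPolynomial.X i : MvPolynomial (Fin 3) ℂ)) := by
      simpa using hi
    exact h.map (Scheme.ΓSpecIso C.functionField).inv.hom

/-- The `K(C)`-valued point `[s₀ : s₁ : s₂]` of the projective plane. -/
def genericCoordinates (s : Fin 3 → C.functionField) (hs : s ≠ 0) :
    Spec C.functionField ⟶ Plane :=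
  Proj.fromOfGlobalSections (MvPolynomial.homogeneousSubmodule (Fin 3) ℂ) (evalTriple s)
    (map_irrelevant_evalTriple s hs)

theorem basis_ne_zero {V : Submodule ℂ C.functionField} (b : Module.Basis (Fin 3) ℂ V) :
    (fun i => (b i : C.functionField)) ≠ 0 := fun h =>
  b.ne_zero 0 (Subtype.ext (congrFun h 0))

/-- `φ` is the morphism `φ_{|V|} : C ⟶ ℙ²`, `x ↦ [s₀(x) : s₁(x) : s₂(x)]`, in the homogeneous
coordinates given by a basis `s₀, s₁, s₂` of `V`: it is the (unique) morphism whose restriction to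
the generic point of `C` is the `K(C)`-valued point `[s₀ : s₁ : s₂]`. -/
def IsMapOfSeries {V : Submodule ℂ C.functionField} (b : Module.Basis (Fin 3) ℂ V)
    (φ : C ⟶ Plane) : Prop :=
  C.fromSpecStalk (genericPoint C) ≫ φ =
    genericCoordinates (fun i => (b i : C.functionField)) (basis_ne_zero b)

/-- A morphism is birational if it restricts to an isomorphism between dense open subschemes. -/
def IsBirationalMorphism {X Y : Scheme.{0}} (f : X ⟶ Y) : Prop :=
  ∃ e : X.PartialIso Y, e.toRationalMap = f.toPartialMap.toRationalMap

/-- The multiplicity at the point `p` of the scheme-theoretic image `Z` of `φ : C ⟶ ℙ²`: the order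
at `p` of the ideal of the plane curve `Z`, that is, the largest `m` such that the kernel of
`𝒪_{ℙ², p} ⟶ 𝒪_{Z, p}` lies in the `m`-th power of the maximal ideal of `𝒪_{ℙ², p}`. -/
def imageMultiplicity (φ : C ⟶ Plane) (p : φ.image) : ℕ :=
  sSup {m : ℕ | RingHom.ker (φ.imageι.stalkMap p).hom ≤
    IsLocalRing.maximalIdeal (Plane.presheaf.stalk (φ.imageι p)) ^ m}

end LinearSeries

end

/-! A proper subspace `W` of dimension at least `2` is a pencil, so `rk W = 1` and the
(semi)stability inequality compares `deg L'` with `deg L / 2`. If `W` generates `L`, then `deg L' =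
deg L`. Otherwise `W` has a base point at some closed point `x`. The members of `V` vanishing at `x`
relative to `L` already form a plane, so `W` is that plane: the pencil of lines through `p = φ(x)`.
Everything rests on the formula `deg L' = deg L - m_p` for this pencil (`exists_pencil`). The
pencils that generate `L` cause no trouble: multiplicities are nonnegative, so the condition at any
one closed point implies theirs (`forall_degree_iff`).

The formula is proved through field degrees. Two independent functions `f, g` generate a line bundle
whose degree is the number of poles of a quotient of the two, which is `[K(C) : ℂ(g/f)]`
(`exists_generates_span_pair`). The pole count is the identity `∑ e f = n` for the integral closure
of `ℂ[h]` in `K(C)` (`finsum_max_ord`). It applies because closed points of `C` correspond to the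
nontrivial valuation rings of `K(C)` over `ℂ`, by smoothness and the valuative criteria
(`isPlaceSystem_placeRing`).

Let `u, v` be affine coordinates centred at a point of the plane. Birationality gives `K(C) = ℂ(u,
v)`, and the relations between `u` and `v` are the multiples of one equation `F` of degree `d`.
Substituting `v = (v/u) u` in `F` and removing the factor `u ^ m`, with `m` the order of `F` at the
origin, leaves a polynomial of degree `d - m` that is minimal for `u` over `ℂ(v/u)` up to a scalar.
Hence `[K(C) : ℂ(v/u)] = d - m` (`finrank_adjoin_slope`). A centre off the curve has `m = 0` and its
pencil generates `L`, so `deg L = d` (`degree_eq_natDegree_radial`). At `p` on the curve, `m` is the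
multiplicity (`imageMultiplicity_toImage`). -/

namespace PlaneCurve

/-! ### Order at the origin and degree of a polynomial in two variables. -/

open Polynomial

variable {k K : Type*} [Field k] [Field K] [Algebra k K]

/-- The substitution `f(X, Y) ↦ f(X, G X)`, with `G` the slope of a line through the origin. The
powers of the outer variable record the total degree. -/
noncomputable def radial (k : Type*) [Field k] : MvPolynomial (Fin 2) k →ₐ[k] k[X][X] :=
  MvPolynomial.aeval ![X, C X * X]

theorem radial_X_zero : radial k (MvPolynomial.X 0) = X := by simp [radial]

theorem radial_X_one : radial k (MvPolynomial.X 1) = C X * X := by simp [radial]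

theorem radial_monomial (e : Fin 2 →₀ ℕ) (c : k) :
    radial k (MvPolynomial.monomial e c) = monomial e.degree (monomial (e 1) c) := by
  rw [radial, MvPolynomial.aeval_monomial, Finsupp.prod_fintype _ _ (by simp), Fin.prod_univ_two]
  simp only [Matrix.cons_val_zero, Matrix.cons_val_one, Finsupp.degree_eq_sum, Fin.sum_univ_two,
    mul_pow, ← C_pow]
  rw [← C_mul_X_pow_eq_monomial, ← C_mul_X_pow_eq_monomial, C_mul, pow_add]
  rw [show (algebraMap k k[X][X]) c = C (C c) from rfl]
  ring

/-- A bidegree is determined by its total degree and its second entry, so `radial` merely relabels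
coefficients. Injectivity, the order at the origin and the total degree are all read off from this.
-/
theorem coeff_coeff_radial (p : MvPolynomial (Fin 2) k) (e : Fin 2 →₀ ℕ) :
    ((radial k p).coeff e.degree).coeff (e 1) = p.coeff e := by
  induction p using MvPolynomial.induction_on' with
  | monomial e' c =>
    rw [radial_monomial, coeff_monomial, MvPolynomial.coeff_monomial]
    by_cases h : e' = e
    · subst h; simp
    · rw [if_neg h]
      split_ifs with hd
      · rw [coeff_monomial, if_neg]
        intro h1
        apply h
        simp only [Finsupp.degree_eq_sum, Fin.sum_univ_two] at hd
        ext i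
        fin_cases i <;> simp <;> omega
      · simp
  | add p q hp hq => simp [hp, hq]

theorem coeff_radial_eq_zero {p : MvPolynomial (Fin 2) k} {n : ℕ}
    (h : ∀ e : Fin 2 →₀ ℕ, e.degree = n → p.coeff e = 0) : (radial k p).coeff n = 0 := by
  rw [← MvPolynomial.support_sum_monomial_coeff p, map_sum, finsetSum_coeff]
  refine Finset.sum_eq_zero fun e he => ?_
  rw [radial_monomial, coeff_monomial, if_neg]
  intro hd
  exact MvPolynomial.mem_support_iff.mp he (h e hd)

theorem radial_injective : Function.Injective (radial k) := by
  rw [injective_iff_map_eq_zero]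
  intro p hp
  ext e
  rw [← coeff_coeff_radial, hp]
  simp

theorem mem_pow_idealOfVars_iff_X_pow_dvd (p : MvPolynomial (Fin 2) k) (n : ℕ) :
    p ∈ MvPolynomial.idealOfVars (Fin 2) k ^ n ↔ X ^ n ∣ radial k p := by
  rw [MvPolynomial.mem_pow_idealOfVars_iff, X_pow_dvd_iff]
  constructor
  · intro h d hd
    refine coeff_radial_eq_zero fun e he => ?_
    by_contra hc
    have := h e (MvPolynomial.mem_support_iff.mpr hc)
    omega
  · intro h e he
    by_contra! hlt
    apply MvPolynomial.mem_support_iff.mp he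
    rw [← coeff_coeff_radial, h _ hlt, coeff_zero]

theorem natDegree_radial (p : MvPolynomial (Fin 2) k) :
    (radial k p).natDegree = p.totalDegree := by
  have hdeg : ∀ e : Fin 2 →₀ ℕ, (e.sum fun _ n => n) = e.degree := fun e => rfl
  apply le_antisymm
  · rw [natDegree_le_iff_coeff_eq_zero]
    intro n hn
    refine coeff_radial_eq_zero fun e he => ?_
    by_contra hc
    have := MvPolynomial.le_totalDegree (MvPolynomial.mem_support_iff.mpr hc)
    rw [hdeg] at this
    omega
  · refine Finset.sup_le fun e he => ?_
    rw [hdeg]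
    apply le_natDegree_of_ne_zero
    intro h
    apply MvPolynomial.mem_support_iff.mp he
    rw [← coeff_coeff_radial, h, coeff_zero]

/-- The order of vanishing at the origin of a nonzero polynomial in two variables. -/
theorem sSup_mem_pow_idealOfVars {p : MvPolynomial (Fin 2) k} (hp : p ≠ 0) :
    sSup {n | p ∈ MvPolynomial.idealOfVars (Fin 2) k ^ n} = (radial k p).natTrailingDegree := by
  have h0 : radial k p ≠ 0 := (map_ne_zero_iff _ radial_injective).mpr hp
  have : {n | p ∈ MvPolynomial.idealOfVars (Fin 2) k ^ n} =
      Set.Iic (radial k p).natTrailingDegree := by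
    ext n
    rw [Set.mem_ofPred_eq, mem_pow_idealOfVars_iff_X_pow_dvd, Set.mem_Iic, X_pow_dvd_iff]
    exact ⟨fun h => le_natTrailingDegree h0 h,
      fun h d hd => coeff_eq_zero_of_lt_natTrailingDegree (hd.trans_le h)⟩
  rw [this, csSup_Iic]

/-- The image of `radial` is spanned by the `G ^ m * X ^ n` with `m ≤ n`, and a large power of `X`
moves any polynomial into that range. -/
theorem exists_radial_eq_X_pow_mul (q : k[X][X]) : ∃ N p, radial k p = X ^ N * q := by
  have hadd : ∀ q₁ q₂ : k[X][X], (∃ N p, radial k p = X ^ N * q₁) →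
      (∃ N p, radial k p = X ^ N * q₂) → ∃ N p, radial k p = X ^ N * (q₁ + q₂) := by
    rintro q₁ q₂ ⟨N₁, p₁, h₁⟩ ⟨N₂, p₂, h₂⟩
    refine ⟨N₁ + N₂, MvPolynomial.X 0 ^ N₂ * p₁ + MvPolynomial.X 0 ^ N₁ * p₂, ?_⟩
    rw [map_add, map_mul, map_mul, map_pow, map_pow, radial_X_zero, h₁, h₂]
    ring
  induction q using Polynomial.induction_on' with
  | add q₁ q₂ h₁ h₂ => exact hadd q₁ q₂ h₁ h₂
  | monomial n a =>
    induction a using Polynomial.induction_on' with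
    | add a₁ a₂ h₁ h₂ =>
      rw [map_add]
      exact hadd _ _ h₁ h₂
    | monomial m c =>
      refine ⟨m, MvPolynomial.C c * MvPolynomial.X 0 ^ n * MvPolynomial.X 1 ^ m, ?_⟩
      rw [map_mul, map_mul, map_pow, map_pow, radial_X_zero, radial_X_one,
        ← C_mul_X_pow_eq_monomial, ← C_mul_X_pow_eq_monomial, ← MvPolynomial.algebraMap_eq,
        AlgHom.commutes, show (algebraMap k k[X][X]) c = C (C c) from rfl, C_mul, C_pow]
      ring

theorem eval₂_radial {u v : K} (hu : u ≠ 0) (p : MvPolynomial (Fin 2) k) :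
    eval₂ (aeval (v / u) : k[X] →ₐ[k] K).toRingHom u (radial k p) =
      MvPolynomial.aeval ![u, v] p := by
  induction p using MvPolynomial.induction_on with
  | C a =>
    rw [← MvPolynomial.algebraMap_eq, AlgHom.commutes, AlgHom.commutes,
      show (algebraMap k k[X][X]) a = C (C a) from rfl, eval₂_C]
    simp
  | add p q hp hq => rw [map_add, eval₂_add, hp, hq, map_add]
  | mul_X p i hp =>
    rw [map_mul, eval₂_mul, hp, map_mul]
    congr 1
    fin_cases i
    · simp [radial_X_zero]
    · simp [radial_X_one, hu]

end PlaneCurve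

namespace PlaneCurve

/-! ### Degree of the projection of a plane curve from a point. -/

open Polynomial

variable {k K : Type*} [Field k] [Field K] [Algebra k K]

/-- Clearing denominators. It will be applied to the minimal polynomial of `u` over the field
generated by the slope. -/
theorem natDegree_integerNormalization {R F : Type*} [CommRing R] [IsDomain R] [Field F]
    [Algebra R F] [IsFractionRing R F] (μ : F[X]) (hμ : μ ≠ 0) :
    ∃ q : R[X], q ≠ 0 ∧ q.natDegree = μ.natDegree ∧ μ ∣ q.map (algebraMap R F) := by
  obtain ⟨b, hbM, hb⟩ := IsLocalization.integerNormalization_spec (nonZeroDivisors R) μ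
  have hb0 : algebraMap R F b ≠ 0 := IsFractionRing.to_map_ne_zero_of_mem_nonZeroDivisors hbM
  have h : (IsLocalization.integerNormalization (nonZeroDivisors R) μ).map (algebraMap R F) =
      C (algebraMap R F b) * μ := by
    rw [hb, ← smul_eq_C_mul, algebraMap_smul]
  have hinj := IsFractionRing.injective R F
  refine ⟨_, ?_, ?_, ⟨_, h.trans (mul_comm _ _)⟩⟩
  · intro h0
    rw [h0, Polynomial.map_zero, eq_comm] at h
    exact mul_ne_zero (C_ne_zero.mpr hb0) hμ h
  · rw [← natDegree_map_eq_of_injective hinj, h, natDegree_C_mul hb0]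

/-- The algebra structure of `k(g)` over `k[X]` in which `X` acts by `g`. -/
@[reducible] noncomputable def polynomialAlgebraAdjoin (g : K) :
    Algebra k[X] (IntermediateField.adjoin k {g}) :=
  (aeval (IntermediateField.AdjoinSimple.gen k g) :
    k[X] →ₐ[k] IntermediateField.adjoin k {g}).toRingHom.toAlgebra

theorem algebraMap_polynomialAlgebraAdjoin_injective {g : K} (hg : Transcendental k g) :
    letI := polynomialAlgebraAdjoin (k := k) g
    Function.Injective (algebraMap k[X] (IntermediateField.adjoin k {g})) :=
  transcendental_iff_injective.mp fun h => hg (h.algebraMap (A := K))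

theorem isFractionRing_polynomialAlgebraAdjoin {g : K} (hg : Transcendental k g) :
    letI := polynomialAlgebraAdjoin (k := k) g
    IsFractionRing k[X] (IntermediateField.adjoin k {g}) := by
  let := polynomialAlgebraAdjoin (k := k) g
  have := (faithfulSMul_iff_algebraMap_injective k[X] (IntermediateField.adjoin k {g})).mpr
    (algebraMap_polynomialAlgebraAdjoin_injective hg)
  refine IsFractionRing.of_field k[X] _ fun z => ?_
  obtain ⟨r, s, h⟩ := (IntermediateField.mem_adjoin_simple_iff k _).mp z.2
  refine ⟨r, s, Subtype.ext ?_⟩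
  rw [h]
  simp [RingHom.algebraMap_toAlgebra]

/-- The degree of the projection of a plane curve from the origin is the degree of the curve minus
its multiplicity at the origin. -/
theorem finrank_adjoin_slope {u v : K} (hu : u ≠ 0) (hg : Transcendental k (v / u))
    (hK : IntermediateField.adjoin k {u, v} = ⊤) {f : MvPolynomial (Fin 2) k} (hf0 : f ≠ 0)
    (hf : RingHom.ker (MvPolynomial.aeval (R := k) ![u, v]) = Ideal.span {f}) :
    Module.finrank (IntermediateField.adjoin k {v / u}) K + (radial k f).natTrailingDegree =
      (radial k f).natDegree := by
  set g := v / u with hgdef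
  set F := IntermediateField.adjoin k {g} with hF
  have hgF : g ∈ F := IntermediateField.subset_adjoin k _ rfl
  let g' : F := ⟨g, hgF⟩
  let : Algebra k[X] F := polynomialAlgebraAdjoin g
  have halg : ∀ p : k[X], algebraMap k[X] F p = aeval g' p := fun _ => rfl
  have hinj : Function.Injective (algebraMap k[X] F) :=
    algebraMap_polynomialAlgebraAdjoin_injective hg
  have : IsFractionRing k[X] F := isFractionRing_polynomialAlgebraAdjoin hg
  have hθ0 : radial k f ≠ 0 := (map_ne_zero_iff _ radial_injective).mpr hf0
  have hev : ∀ q : k[X][X], aeval u (q.map (algebraMap k[X] F)) =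
      eval₂ (aeval g : k[X] →ₐ[k] K).toRingHom u q := by
    intro q
    rw [aeval_def, eval₂_map]
    congr 1
    ext p
    · simp [halg]
    · simp [halg, g']
  have hfu : MvPolynomial.aeval ![u, v] f = 0 := by
    have : f ∈ RingHom.ker (MvPolynomial.aeval (R := k) ![u, v]) := by
      rw [hf]; exact Ideal.mem_span_singleton_self f
    exact this
  -- The factor `X ^ m` takes the nonzero value `u ^ m`, so the cofactor `q₁` still kills `u`. It
  -- bounds the degree of `u` over `F` from above.
  obtain ⟨q₁, hq₁⟩ : X ^ (radial k f).natTrailingDegree ∣ radial k f :=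
    X_pow_dvd_iff.mpr fun d hd => coeff_eq_zero_of_lt_natTrailingDegree hd
  have hq₁0 : q₁ ≠ 0 := by
    rintro rfl
    exact hθ0 (by rw [hq₁, mul_zero])
  have hq₁u : aeval u (q₁.map (algebraMap k[X] F)) = 0 := by
    have := eval₂_radial hu (v := v) f
    rw [hfu, hq₁, eval₂_mul, eval₂_X_pow, ← hev] at this
    exact (mul_eq_zero.mp this).resolve_left (pow_ne_zero _ hu)
  have hq₁F : q₁.map (algebraMap k[X] F) ≠ 0 := (Polynomial.map_ne_zero_iff hinj).mpr hq₁0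
  have hdeg₁ : (radial k f).natDegree = (radial k f).natTrailingDegree + q₁.natDegree := by
    conv_lhs => rw [hq₁]
    rw [natDegree_mul (pow_ne_zero _ X_ne_zero) hq₁0, natDegree_X_pow]
  have hIntegral : IsIntegral F u := IsAlgebraic.isIntegral ⟨_, hq₁F, hq₁u⟩
  have htop : IntermediateField.adjoin F {u} = ⊤ := by
    rw [← IntermediateField.restrictScalars_eq_top_iff (K := k), eq_top_iff, ← hK,
      IntermediateField.adjoin_le_iff]
    have hu' : u ∈ (IntermediateField.adjoin F {u}).restrictScalars k :=
      IntermediateField.subset_adjoin F {u} rfl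
    rintro z (rfl | rfl)
    · exact hu'
    · have : g ∈ (IntermediateField.adjoin F {u}).restrictScalars k :=
        (IntermediateField.adjoin F {u}).algebraMap_mem g'
      have h2 := mul_mem this hu'
      rwa [hgdef, div_mul_cancel₀ _ hu] at h2
  have hrank : Module.finrank F K = (minpoly F u).natDegree := by
    rw [← IntermediateField.adjoin.finrank hIntegral, htop, IntermediateField.finrank_top']
  rw [hrank]
  apply le_antisymm
  · rw [hdeg₁, add_comm]
    have := natDegree_le_of_dvd (minpoly.dvd F u hq₁u) hq₁F
    rw [natDegree_map_eq_of_injective hinj] at this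
    omega
  -- Lower bound: the minimal polynomial, cleared of denominators and multiplied by a power of `X`,
  -- comes from a relation between `u` and `v`, hence from a multiple of `f`. Degree minus trailing
  -- degree is additive on products and unaffected by powers of `X`.
  · obtain ⟨q, hq0, hqd, hqdvd⟩ :=
      natDegree_integerNormalization (R := k[X]) (minpoly F u) (minpoly.ne_zero hIntegral)
    have hqu : aeval u (q.map (algebraMap k[X] F)) = 0 := by
      obtain ⟨r, hr⟩ := hqdvd
      rw [hr, map_mul, minpoly.aeval, zero_mul]
    obtain ⟨N, p, hp⟩ := exists_radial_eq_X_pow_mul q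
    have hpu : p ∈ RingHom.ker (MvPolynomial.aeval (R := k) ![u, v]) := by
      rw [RingHom.mem_ker, ← eval₂_radial hu, hp, eval₂_mul, ← hev q, hqu, mul_zero]
    rw [hf, Ideal.mem_span_singleton] at hpu
    obtain ⟨r, rfl⟩ := hpu
    rw [map_mul] at hp
    have hr0 : radial k r ≠ 0 := by
      intro h
      rw [h, mul_zero, eq_comm] at hp
      exact mul_ne_zero (pow_ne_zero _ X_ne_zero) hq0 hp
    have h₁ := congrArg natDegree hp
    have h₂ := congrArg natTrailingDegree hp
    rw [natDegree_mul hθ0 hr0, natDegree_mul (pow_ne_zero _ X_ne_zero) hq0, natDegree_X_pow] at h₁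
    rw [natTrailingDegree_mul hθ0 hr0, natTrailingDegree_mul (pow_ne_zero _ X_ne_zero) hq0,
      natTrailingDegree_X_pow] at h₂
    have := natTrailingDegree_le_natDegree (radial k r)
    omega

theorem exists_eval_ne_zero [Infinite k] {f : MvPolynomial (Fin 2) k} (hf : f ≠ 0) :
    ∃ a : Fin 2 → k, MvPolynomial.eval a f ≠ 0 := by
  by_contra! h
  exact hf (MvPolynomial.funext fun a => by simpa using h a)

/-- The translation `f(X, Y) ↦ f(X + a, Y + b)`. -/
noncomputable def translate (a : Fin 2 → k) : MvPolynomial (Fin 2) k →ₐ[k] MvPolynomial (Fin 2) k :=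
  MvPolynomial.aeval fun i => MvPolynomial.X i + MvPolynomial.C (a i)

theorem aeval_translate (a : Fin 2 → k) (w : Fin 2 → K) (p : MvPolynomial (Fin 2) k) :
    MvPolynomial.aeval w (translate a p) =
      MvPolynomial.aeval (fun i => w i + algebraMap k K (a i)) p := by
  rw [translate, ← AlgHom.comp_apply, MvPolynomial.comp_aeval]
  simp

theorem translate_translate_neg (a : Fin 2 → k) (p : MvPolynomial (Fin 2) k) :
    translate a (translate (-a) p) = p := by
  rw [translate, translate, ← AlgHom.comp_apply, MvPolynomial.comp_aeval]
  simp

theorem totalDegree_translate_le (a : Fin 2 → k) (p : MvPolynomial (Fin 2) k) :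
    (translate a p).totalDegree ≤ p.totalDegree := by
  rw [translate, MvPolynomial.aeval_def, MvPolynomial.eval₂_eq]
  refine MvPolynomial.totalDegree_finsetSum_le fun e he => ?_
  refine (MvPolynomial.totalDegree_mul _ _).trans ?_
  rw [MvPolynomial.algebraMap_eq, MvPolynomial.totalDegree_C, zero_add]
  refine (MvPolynomial.totalDegree_finsetProd _ _).trans
    (le_trans ?_ (MvPolynomial.le_totalDegree he))
  refine Finset.sum_le_sum fun i _ => (MvPolynomial.totalDegree_pow _ _).trans ?_
  have : (MvPolynomial.X i + MvPolynomial.C (a i) : MvPolynomial (Fin 2) k).totalDegree ≤ 1 :=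
    (MvPolynomial.totalDegree_add _ _).trans (by simp)
  nlinarith

theorem totalDegree_translate (a : Fin 2 → k) (p : MvPolynomial (Fin 2) k) :
    (translate a p).totalDegree = p.totalDegree := by
  refine (totalDegree_translate_le a p).antisymm ?_
  have := totalDegree_translate_le (-a) (translate a p)
  rwa [show translate (-a) (translate a p) = p by
    simpa using translate_translate_neg (-a) p] at this

theorem constantCoeff_translate (a : Fin 2 → k) (p : MvPolynomial (Fin 2) k) :
    MvPolynomial.constantCoeff (translate a p) = MvPolynomial.eval a p := by
  have := aeval_translate (K := k) a 0 p
  simpa [MvPolynomial.constantCoeff_eq, MvPolynomial.aeval_eq_eval, MvPolynomial.eval_zero'] using this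

theorem ker_aeval_translate (a : Fin 2 → k) {w : Fin 2 → K} {f : MvPolynomial (Fin 2) k}
    (hf : RingHom.ker (MvPolynomial.aeval (R := k) w) = Ideal.span {f}) :
    RingHom.ker (MvPolynomial.aeval (R := k) fun i => w i - algebraMap k K (a i)) =
      Ideal.span {translate a f} := by
  have key : ∀ p, MvPolynomial.aeval (fun i => w i - algebraMap k K (a i)) (translate a p) =
      MvPolynomial.aeval w p := by
    intro p
    rw [aeval_translate]
    simp
  ext p
  rw [Ideal.mem_span_singleton]
  obtain ⟨p, rfl⟩ : ∃ q, translate a q = p := ⟨_, translate_translate_neg a p⟩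
  rw [RingHom.mem_ker, key, ← RingHom.mem_ker, hf, Ideal.mem_span_singleton]
  refine ⟨map_dvd _, fun h => ?_⟩
  have := map_dvd (translate (-a)) h
  have hl : ∀ q, translate (-a) (translate a q) = q := fun q => by
    simpa using translate_translate_neg (-a) q
  rwa [hl, hl] at this

/-- The degree of the projection of a plane curve from a point off the curve is the degree of the
curve. -/
theorem finrank_adjoin_slope_of_eval_ne_zero {u v : K} {a : Fin 2 → k}
    (hu : u - algebraMap k K (a 0) ≠ 0)
    (hg : Transcendental k ((v - algebraMap k K (a 1)) / (u - algebraMap k K (a 0))))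
    (hK : IntermediateField.adjoin k {u, v} = ⊤) {f : MvPolynomial (Fin 2) k}
    (hf : RingHom.ker (MvPolynomial.aeval (R := k) ![u, v]) = Ideal.span {f})
    (ha : MvPolynomial.eval a f ≠ 0) :
    Module.finrank (IntermediateField.adjoin k
      {(v - algebraMap k K (a 1)) / (u - algebraMap k K (a 0))}) K =
      (radial k f).natDegree := by
  have hker := ker_aeval_translate a hf
  have hvec : (fun i => ![u, v] i - algebraMap k K (a i)) =
      ![u - algebraMap k K (a 0), v - algebraMap k K (a 1)] := by
    ext i
    fin_cases i <;> rfl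
  rw [hvec] at hker
  have hc : MvPolynomial.constantCoeff (translate a f) ≠ 0 := by
    rwa [constantCoeff_translate]
  -- The centre is off the curve, so the translated equation has a nonzero constant term and order
  -- zero.
  have htr : (radial k (translate a f)).natTrailingDegree = 0 := by
    apply natTrailingDegree_eq_zero_of_constantCoeff_ne_zero
    intro h
    apply hc
    have := coeff_coeff_radial (translate a f) 0
    simp only [map_zero, Finsupp.coe_zero, Pi.zero_apply] at this
    rw [MvPolynomial.constantCoeff_eq, ← this]
    rw [constantCoeff_apply] at h
    rw [h, coeff_zero]
  have hK' : IntermediateField.adjoin k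
      {u - algebraMap k K (a 0), v - algebraMap k K (a 1)} = ⊤ := by
    rw [eq_top_iff, ← hK, IntermediateField.adjoin_le_iff]
    have h : ∀ z c, z - algebraMap k K c ∈ ({u - algebraMap k K (a 0),
        v - algebraMap k K (a 1)} : Set K) → z ∈ IntermediateField.adjoin k
        {u - algebraMap k K (a 0), v - algebraMap k K (a 1)} := by
      intro z c hz
      have := add_mem (IntermediateField.subset_adjoin k _ hz)
        (IntermediateField.algebraMap_mem _ c)
      rwa [sub_add_cancel] at this
    rintro z (rfl | rfl)
    · exact h _ (a 0) (by simp)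
    · exact h _ (a 1) (by simp)
  have := finrank_adjoin_slope hu hg hK' (f := translate a f) (by
    rintro h
    exact hc (by rw [h, map_zero])) hker
  rw [htr, add_zero] at this
  rw [this, natDegree_radial, natDegree_radial, totalDegree_translate]

/-- An algebraically dependent pair, one member of which is transcendental, satisfies a single
irreducible equation. -/
theorem exists_ker_aeval_eq_span {w : Fin 2 → K} (hw : ¬ AlgebraicIndependent k w)
    (hu : Transcendental k (w 0)) :
    ∃ f : MvPolynomial (Fin 2) k, f ≠ 0 ∧
      RingHom.ker (MvPolynomial.aeval (R := k) w) = Ideal.span {f} := by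
  set P := RingHom.ker (MvPolynomial.aeval (R := k) w) with hP
  have hprime : P.IsPrime := RingHom.ker_isPrime _
  have hPbot : P ≠ ⊥ := by
    intro h
    exact hw ((RingHom.injective_iff_ker_eq_bot _).mpr h)
  -- By the Nullstellensatz a maximal `P` would have a residue field finite over `k`, making `w 0`
  -- algebraic. So `P` has height one in a factorial ring of dimension two and is principal.
  have hmax : ¬ P.IsMaximal := by
    intro hmax
    let := Ideal.Quotient.field P
    have : Algebra.FiniteType k (MvPolynomial (Fin 2) k ⧸ P) :=
      .of_surjective (Ideal.Quotient.mkₐ k P) (Ideal.Quotient.mkₐ_surjective k P)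
    have := finite_of_finite_type_of_isJacobsonRing k (MvPolynomial (Fin 2) k ⧸ P)
    have h := (Algebra.IsIntegral.isIntegral (R := k) (Ideal.Quotient.mk P (MvPolynomial.X 0))).map
      (Ideal.Quotient.liftₐ P (MvPolynomial.aeval w) fun a ha => ha)
    replace h : IsIntegral k (MvPolynomial.aeval w (MvPolynomial.X 0)) := h
    exact hu (IsIntegral.isAlgebraic (by simpa using h))
  obtain ⟨M, hM, hPM⟩ := P.exists_le_maximal hprime.ne_top
  have hlt : P < M := lt_of_le_of_ne hPM fun h => hmax (h ▸ hM)
  have h1 := Ideal.height_add_one_le_of_lt_of_isPrime hlt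
  have h2 : (M.height : WithBot ℕ∞) ≤ 2 := by
    have h := Ideal.height_le_ringKrullDim_of_isPrime (I := M)
    rw [MvPolynomial.ringKrullDim_of_isNoetherianRing, ringKrullDim_eq_zero_of_field] at h
    simpa using h
  have h3 : P.height ≤ 1 := by
    have : P.height + 1 ≤ 1 + 1 := h1.trans (by
      rw [one_add_one_eq_two]
      exact WithBot.coe_le_coe.mp h2)
    exact (ENat.add_le_add_iff_right ENat.one_ne_top).mp this
  have h4 : 1 ≤ P.height := by
    rw [Order.one_le_iff_ne_zero]
    exact fun h => hPbot (Ideal.height_eq_zero_iff_eq_bot.mp h)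
  obtain ⟨f, hf⟩ := UniqueFactorizationMonoid.isPrincipal_of_height_eq_one (h3.antisymm h4)
  refine ⟨f, ?_, hf⟩
  rintro rfl
  exact hPbot (by simpa using hf)

end PlaneCurve

namespace PlaneCurve

/-! ### Zeros and poles in a field with a system of discrete places. -/

open Polynomial IsDedekindDomain WithZero

/-- The valuation rings `A i` are all the nontrivial valuation rings of `K` over `k`, each of them
once, and each of them is discrete with normalized valuation `ord i`. -/
structure IsPlaceSystem (k : Type*) {K ι : Type*} [Field k] [Field K] [Algebra k K]
    (A : ι → ValuationSubring K) (ord : ι → K → ℤ) : Prop where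
  ord_mul : ∀ i {f g : K}, f ≠ 0 → g ≠ 0 → ord i (f * g) = ord i f + ord i g
  ord_nonneg_iff : ∀ i {f : K}, f ≠ 0 → (0 ≤ ord i f ↔ f ∈ A i)
  exists_ord_eq_one : ∀ i, ∃ t : K, t ≠ 0 ∧ ord i t = 1
  algebraMap_mem : ∀ i (c : k), algebraMap k K c ∈ A i
  injective : Function.Injective A
  surjective : ∀ B : ValuationSubring K, (∀ c : k, algebraMap k K c ∈ B) → B ≠ ⊤ → ∃ i, A i = B

namespace IsPlaceSystem

variable {k K ι : Type*} [Field k] [Field K] [Algebra k K]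
  {A : ι → ValuationSubring K} {ord : ι → K → ℤ}

theorem ord_one (H : IsPlaceSystem k A ord) (i : ι) : ord i 1 = 0 := by
  have := H.ord_mul i (one_ne_zero (α := K)) one_ne_zero
  rw [mul_one] at this
  omega

theorem ord_inv (H : IsPlaceSystem k A ord) (i : ι) {f : K} (hf : f ≠ 0) :
    ord i f⁻¹ = - ord i f := by
  have := H.ord_mul i hf (inv_ne_zero hf)
  rw [mul_inv_cancel₀ hf, H.ord_one] at this
  omega

theorem ord_div (H : IsPlaceSystem k A ord) (i : ι) {f g : K} (hf : f ≠ 0) (hg : g ≠ 0) :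
    ord i (f / g) = ord i f - ord i g := by
  rw [div_eq_mul_inv, H.ord_mul i hf (inv_ne_zero hg), H.ord_inv i hg, sub_eq_add_neg]

theorem ord_pow (H : IsPlaceSystem k A ord) (i : ι) {f : K} (hf : f ≠ 0) (n : ℕ) :
    ord i (f ^ n) = n * ord i f := by
  induction n with
  | zero => simp [H.ord_one]
  | succ n ih =>
    rw [pow_succ, H.ord_mul i (pow_ne_zero _ hf) hf, ih]
    push_cast
    ring

theorem ord_zpow (H : IsPlaceSystem k A ord) (i : ι) {f : K} (hf : f ≠ 0) (n : ℤ) :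
    ord i (f ^ n) = n * ord i f := by
  obtain ⟨m, rfl | rfl⟩ := n.eq_nat_or_neg
  · rw [zpow_natCast, H.ord_pow i hf]
  · rw [zpow_neg, zpow_natCast, H.ord_inv i (pow_ne_zero _ hf), H.ord_pow i hf]
    ring

theorem ord_eq_zero_of_mem (H : IsPlaceSystem k A ord) (i : ι) {f : K} (hf : f ≠ 0)
    (h : f ∈ A i) (h' : f⁻¹ ∈ A i) : ord i f = 0 := by
  have h1 := (H.ord_nonneg_iff i hf).mpr h
  have h2 := (H.ord_nonneg_iff i (inv_ne_zero hf)).mpr h'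
  rw [H.ord_inv i hf] at h2
  omega

theorem ord_algebraMap (H : IsPlaceSystem k A ord) (i : ι) {c : k} (hc : c ≠ 0) :
    ord i (algebraMap k K c) = 0 := by
  refine H.ord_eq_zero_of_mem i ?_ (H.algebraMap_mem i c) ?_
  · simpa using hc
  · rw [← map_inv₀]
    exact H.algebraMap_mem i _

theorem ne_top (H : IsPlaceSystem k A ord) (i : ι) : A i ≠ ⊤ := by
  intro h
  obtain ⟨t, ht, ht1⟩ := H.exists_ord_eq_one i
  have := (H.ord_nonneg_iff i (inv_ne_zero ht)).mpr (h ▸ ValuationSubring.mem_top _)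
  rw [H.ord_inv i ht, ht1] at this
  omega

/-- Both sides come from the same valuation ring. Dividing by a power of a uniformizer `π` of `v`
leaves a unit, so every order is a multiple of `ord i π`; as the order `1` occurs and `π` is
integral, `ord i π = 1`. -/
theorem valuation_eq_exp_neg_ord (H : IsPlaceSystem k A ord) {R : Type*} [CommRing R]
    [IsDedekindDomain R] [Algebra R K] [IsFractionRing R K] (v : HeightOneSpectrum R) {i : ι}
    (hi : A i = (v.valuation K).valuationSubring) {f : K} (hf : f ≠ 0) :
    v.valuation K f = exp (-ord i f) := by
  obtain ⟨π, hπ⟩ := v.valuation_exists_uniformizer K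
  have hπ0 : π ≠ 0 := by
    rintro rfl
    rw [map_zero] at hπ
    exact exp_ne_zero hπ.symm
  have key : ∀ {g : K}, g ≠ 0 → ∃ n : ℤ, v.valuation K g = exp (-n) ∧ ord i g = n * ord i π := by
    intro g hg
    have hvg : v.valuation K g ≠ 0 := (Valuation.ne_zero_iff _).mpr hg
    refine ⟨-log (v.valuation K g), ?_, ?_⟩
    · rw [neg_neg, exp_log hvg]
    · set n := -log (v.valuation K g) with hn
      have hπn : π ^ n ≠ 0 := zpow_ne_zero _ hπ0
      have hval : v.valuation K (g / π ^ n) = 1 := by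
        rw [map_div₀, map_zpow₀, hπ, ← exp_zsmul, hn]
        simp [exp_log hvg, hvg]
      have h0 : ord i (g / π ^ n) = 0 := by
        refine H.ord_eq_zero_of_mem i (div_ne_zero hg hπn) ?_ ?_
        · rw [hi, Valuation.mem_valuationSubring_iff, hval]
        · rw [hi, Valuation.mem_valuationSubring_iff, map_inv₀, hval, inv_one]
      rw [H.ord_div i hg hπn, H.ord_zpow i hπ0] at h0
      omega
  have hπ1 : ord i π = 1 := by
    obtain ⟨t, ht, ht1⟩ := H.exists_ord_eq_one i
    obtain ⟨m, -, hm⟩ := key ht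
    have hnn : 0 ≤ ord i π := by
      rw [H.ord_nonneg_iff i hπ0, hi, Valuation.mem_valuationSubring_iff, hπ, ← exp_zero, exp_le_exp]
      omega
    rw [ht1] at hm
    exact Int.eq_one_of_dvd_one hnn ⟨m, by rw [hm, mul_comm]⟩
  obtain ⟨n, hn, hn'⟩ := key hf
  rw [hn, hn', hπ1, mul_one]

/-- A place at which a Dedekind domain with field of fractions `K` is regular comes from a maximal
ideal of that domain. -/
theorem exists_eq_valuationSubring (H : IsPlaceSystem k A ord) {R : Type*} [CommRing R]
    [IsDedekindDomain R] [Algebra R K] [IsFractionRing R K] {i : ι}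
    (hR : ∀ r : R, algebraMap R K r ∈ A i) {t : R} (ht : t ≠ 0)
    (hti : 0 < ord i (algebraMap R K t)) :
    ∃ v : HeightOneSpectrum R, A i = (v.valuation K).valuationSubring ∧ t ∈ v.asIdeal := by
  let ψ : R →+* A i := (algebraMap R K).codRestrict (A i).toSubring hR
  have htP : t ∈ (IsLocalRing.maximalIdeal (A i)).comap ψ := by
    rw [Ideal.mem_comap, IsLocalRing.mem_maximalIdeal, mem_nonunits_iff]
    intro hu
    obtain ⟨⟨b, hb⟩, hb1⟩ := hu.exists_right_inv
    have ht0 : algebraMap R K t ≠ 0 := by simpa using ht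
    have hb' : algebraMap R K t * b = 1 := congrArg Subtype.val hb1
    have hb0 : b ≠ 0 := right_ne_zero_of_mul_eq_one hb'
    have h1 := H.ord_mul i ht0 hb0
    rw [hb', H.ord_one] at h1
    have h2 := (H.ord_nonneg_iff i hb0).mpr hb
    omega
  let v : HeightOneSpectrum R :=
    ⟨(IsLocalRing.maximalIdeal (A i)).comap ψ, Ideal.comap_isPrime _ _,
      fun h => ht (by rwa [h, Ideal.mem_bot] at htP)⟩
  refine ⟨v, ?_, htP⟩
  -- Elements outside the contracted maximal ideal are units in `A i`. The localization is a
  -- discrete valuation ring, so no ring lies strictly between it and `K`.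
  have hle : HeightOneSpectrum.valuationSubringAtPrime K v ≤ A i := by
    rintro x ⟨a, s, hs, rfl⟩
    refine mul_mem (hR a) ?_
    have hu : IsUnit (ψ s) := by
      by_contra hns
      exact hs ((IsLocalRing.mem_maximalIdeal _).mpr hns)
    obtain ⟨⟨b, hb⟩, hb1⟩ := hu.exists_right_inv
    have hb' : algebraMap R K s * b = 1 := congrArg Subtype.val hb1
    rwa [← eq_inv_of_mul_eq_one_right hb']
  rw [← HeightOneSpectrum.valuationSubringAtPrime_eq_valuationSubring]
  exact (ValuationSubring.eq_of_le_of_ne_top _ hle (H.ne_top i)).symm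

theorem exists_algebraMap_eq_of_isAlgebraic [IsAlgClosed k] {x : K} (hx : IsAlgebraic k x) :
    ∃ c : k, algebraMap k K c = x :=
  minpoly.mem_range_of_degree_eq_one k x
    (IsAlgClosed.degree_eq_one_of_irreducible k (minpoly.irreducible hx.isIntegral))

theorem finrank_eq_one_of_isAlgClosed {E L : Type*} [Field E] [IsAlgClosed E] [Field L]
    [Algebra E L] [Algebra.IsIntegral E L] : Module.finrank E L = 1 := by
  rw [← (LinearEquiv.ofBijective (Algebra.linearMap E L)
    IsAlgClosed.algebraMap_bijective_of_isIntegral).finrank_eq, Module.finrank_self]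

/-- The number of zeros of a nonconstant function is its degree. -/
theorem finsum_max_ord (H : IsPlaceSystem k A ord) [IsAlgClosed k] [CharZero k] {h : K}
    (hh : Transcendental k h) [FiniteDimensional (IntermediateField.adjoin k {h}) K] :
    {i | 0 < ord i h}.Finite ∧
      ∑ᶠ i, max (ord i h) 0 = Module.finrank (IntermediateField.adjoin k {h}) K := by
  set F := IntermediateField.adjoin k {h}
  let : Algebra k[X] F := polynomialAlgebraAdjoin h
  have := isFractionRing_polynomialAlgebraAdjoin hh
  let : Algebra k[X] K := (aeval h : k[X] →ₐ[k] K).toRingHom.toAlgebra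
  have htower : IsScalarTower k[X] F K := by
    refine IsScalarTower.of_algebraMap_eq' ?_
    ext c
    · simp [RingHom.algebraMap_toAlgebra]
    · simp [RingHom.algebraMap_toAlgebra]
  have : CharZero F := charZero_of_injective_algebraMap (algebraMap k F).injective
  have : IsDedekindDomain (integralClosure k[X] K) := integralClosure.isDedekindDomain k[X] F K
  have : Module.Finite k[X] (integralClosure k[X] K) := IsIntegralClosure.finite k[X] F K _
  have : IsFractionRing (integralClosure k[X] K) K :=
    integralClosure.isFractionRing_of_finite_extension F K
  set B := integralClosure k[X] K with hB
  have hX : ∀ p : k[X], algebraMap B K (algebraMap k[X] B p) = aeval h p := fun _ => rfl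
  let hb : B := algebraMap k[X] B X
  have hbK : algebraMap B K hb = h := by rw [hX, aeval_X]
  have hh0 : h ≠ 0 := fun h0 => hh (h0 ▸ isAlgebraic_zero)
  have hb0 : hb ≠ 0 := by
    intro h0
    rw [h0, map_zero] at hbK
    exact hh0 hbK.symm
  -- As `X` acts by `h`, the zeros of `h` will be the primes of `B` over `p`, with the order of
  -- vanishing as ramification index.
  let p : Ideal k[X] := Ideal.span {X}
  have hpmax : p.IsMaximal := PrincipalIdealRing.isMaximal_of_irreducible irreducible_X
  have hp0 : p ≠ ⊥ := by simp [p]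
  have hpB : p.map (algebraMap k[X] B) = Ideal.span {hb} := by
    rw [Ideal.map_span, Set.image_singleton]
  have hpB0 : p.map (algebraMap k[X] B) ≠ ⊥ := by simpa [hpB] using hb0
  have hqX : ∀ q : Ideal B, q ∈ p.primesOver B → hb ∈ q := by
    rintro q ⟨hq, hqp⟩
    have : X ∈ q.under k[X] := by
      rw [← hqp.over]
      exact Ideal.mem_span_singleton_self X
    exact this
  let v : p.primesOver B → HeightOneSpectrum B := fun q =>
    ⟨q.1, q.2.1, fun h0 => hb0 (by simpa [h0] using hqX q.1 q.2)⟩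
  have hcB : ∀ (w : HeightOneSpectrum B) (c : k),
      algebraMap k K c ∈ (w.valuation K).valuationSubring := by
    intro w c
    rw [Valuation.mem_valuationSubring_iff]
    have : algebraMap k K c = algebraMap B K (algebraMap k[X] B (C c)) := by
      rw [hX, aeval_C]
    rw [this]
    exact w.valuation_le_one _
  have hntop : ∀ w : HeightOneSpectrum B, (w.valuation K).valuationSubring ≠ ⊤ := by
    intro w
    simp only [ne_eq, Valuation.valuationSubring_eq_top_iff, not_not]
    infer_instance
  choose j hj using fun q => H.surjective _ (hcB (v q)) (hntop (v q))
  have hjinj : Function.Injective j := by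
    intro q q' hqq
    have h1 : ((v q).valuation K).valuationSubring = ((v q').valuation K).valuationSubring := by
      rw [← hj, ← hj, hqq]
    have h2 := HeightOneSpectrum.eq_of_valuation_isEquiv_valuation
      ((Valuation.isEquiv_iff_valuationSubring _ _).mpr h1)
    exact Subtype.ext (congrArg HeightOneSpectrum.asIdeal h2)
  have hjord : ∀ q : p.primesOver B, ord (j q) h = q.1.ramificationIdx k[X] := by
    intro q
    have := q.2.1
    have := q.2.2
    have h1 := H.valuation_eq_exp_neg_ord (v q) (hj q) hh0
    rw [← hbK, HeightOneSpectrum.valuation_of_algebraMap,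
      HeightOneSpectrum.intValuation_eq_exp_neg_multiplicity _ hb0, hbK, exp_inj] at h1
    rw [Ideal.IsDedekindDomain.ramificationIdx_eq_multiplicity p q.1 hpB0, hpB]
    simpa using h1.symm
  have hjpos : ∀ q, 0 < ord (j q) h := by
    intro q
    have h1 := H.valuation_eq_exp_neg_ord (v q) (hj q) hh0
    have h2 : (v q).valuation K (algebraMap B K hb) < 1 :=
      (HeightOneSpectrum.valuation_lt_one_iff_mem _ _).mpr (hqX q.1 q.2)
    rw [hbK, h1, ← exp_zero, exp_lt_exp] at h2
    omega
  have hrange : {i | 0 < ord i h} = Set.range j := by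
    ext i
    refine ⟨fun hi => ?_, ?_⟩
    · have hXi : ∀ r : k[X], algebraMap k[X] K r ∈ A i := by
        intro r
        change aeval h r ∈ A i
        rw [aeval_eq_sum_range]
        refine sum_mem fun n _ => ?_
        rw [Algebra.smul_def]
        exact mul_mem (H.algebraMap_mem i _)
          (pow_mem ((H.ord_nonneg_iff i hh0).mp (le_of_lt hi)) n)
      -- A valuation ring is integrally closed, so once it contains `k[h]` it contains `B`.
      have hBi : ∀ b : B, algebraMap B K b ∈ A i := by
        intro b
        let : Algebra k[X] (A i) :=
          ((algebraMap k[X] K).codRestrict (A i).toSubring hXi).toAlgebra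
        have : IsScalarTower k[X] (A i) K := .of_algebraMap_eq fun _ => rfl
        have hIntegral : IsIntegral (A i) (b : K) := (show IsIntegral k[X] (b : K) from b.2).tower_top
        obtain ⟨y, hy⟩ := IsIntegrallyClosed.algebraMap_eq_of_integral hIntegral
        change (b : K) ∈ A i
        rw [← hy]
        exact y.2
      obtain ⟨w, hw, hbw⟩ := H.exists_eq_valuationSubring hBi hb0 (by rwa [hbK])
      have hlies : w.asIdeal.LiesOver p := by
        refine ⟨?_⟩
        refine hpmax.eq_of_le (Ideal.IsPrime.under k[X] w.asIdeal).ne_top ?_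
        rw [Ideal.span_singleton_le_iff_mem]
        exact hbw
      refine ⟨⟨w.asIdeal, w.isPrime, hlies⟩, H.injective ?_⟩
      rw [hj, hw]
    · rintro ⟨q, rfl⟩
      exact hjpos q
  have hinjB : Function.Injective (algebraMap k[X] B) := by
    intro r s hrs
    have := congrArg (algebraMap B K) hrs
    rw [hX, hX] at this
    exact transcendental_iff_injective.mp hh this
  have : FaithfulSMul k[X] B := (faithfulSMul_iff_algebraMap_injective k[X] B).mpr hinjB
  have : Module.IsTorsionFree k[X] B := inferInstance
  have : Module.Free k[X] B := Module.free_of_finite_type_torsion_free'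
  have : Module.Flat k[X] B := .of_free
  have hfin : Finite (p.primesOver B) := Algebra.QuasiFinite.finite_primesOver p
  -- The residue field of `p` is the algebraically closed field `k`, which has no proper finite
  -- extension.
  have hinertia : ∀ q : p.primesOver B, q.1.inertiaDeg k[X] = 1 := by
    intro q
    have := q.2.1
    have := q.2.2
    have hqmax : q.1.IsMaximal := (v q).isMaximal
    rw [Ideal.inertiaDeg_eq_of_isMaximal p q.1]
    let := Ideal.Quotient.field p
    let := Ideal.Quotient.field q.1
    have : IsAlgClosed (k[X] ⧸ p) := IsAlgClosed.of_ringEquiv k (k[X] ⧸ p)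
      ((Ideal.quotEquivOfEq (by simp [p])).trans
        (quotientSpanXSubCAlgEquiv (0 : k)).toRingEquiv).symm
    exact finrank_eq_one_of_isAlgClosed
  refine ⟨hrange ▸ Set.finite_range j, ?_⟩
  have hsupp : Function.support (fun i => max (ord i h) 0) ⊆ Set.range j := by
    rw [← hrange]
    intro i hi
    by_contra hle
    exact hi (max_eq_right (not_lt.mp hle))
  rw [← finsum_mem_univ, ← finsum_mem_inter_support, Set.univ_inter,
    ← Set.inter_eq_right.mpr hsupp, finsum_mem_inter_support, finsum_mem_range hjinj]
  let := Fintype.ofFinite (p.primesOver B)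
  rw [finsum_eq_sum_of_fintype, IsFractionRing.finrank_eq k[X] F B K,
    ← Ideal.sum_ramification_inertia_eq_finrank p B, Nat.cast_sum]
  refine Finset.sum_congr rfl fun q _ => ?_
  rw [max_eq_left (hjpos q).le, hjord, hinertia, mul_one]

/-- The number of poles of a nonconstant function is its degree. -/
theorem finsum_max_neg_ord (H : IsPlaceSystem k A ord) [IsAlgClosed k] [CharZero k] {h : K}
    (hh : Transcendental k h) [FiniteDimensional (IntermediateField.adjoin k {h}) K] :
    {i | ord i h < 0}.Finite ∧
      ∑ᶠ i, max (-ord i h) 0 = Module.finrank (IntermediateField.adjoin k {h}) K := by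
  have hh0 : h ≠ 0 := fun h0 => hh (h0 ▸ isAlgebraic_zero)
  have hadj : IntermediateField.adjoin k {h⁻¹} = IntermediateField.adjoin k {h} := by
    apply le_antisymm <;> rw [IntermediateField.adjoin_simple_le_iff]
    · exact inv_mem (IntermediateField.mem_adjoin_simple_self k h)
    · simpa using inv_mem (IntermediateField.mem_adjoin_simple_self k h⁻¹)
  have hhi : Transcendental k h⁻¹ := fun h0 => hh (by simpa using h0.inv)
  have : FiniteDimensional (IntermediateField.adjoin k {h⁻¹}) K := by
    rw [hadj]
    infer_instance
  have := H.finsum_max_ord hhi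
  simp only [H.ord_inv _ hh0] at this
  rw [hadj] at this
  simpa only [Left.neg_pos_iff] using this

/-- A nonzero function has as many zeros as poles. -/
theorem finsum_ord (H : IsPlaceSystem k A ord) [IsAlgClosed k] [CharZero k]
    (hfin : ∀ h : K, Transcendental k h → FiniteDimensional (IntermediateField.adjoin k {h}) K)
    {f : K} (hf : f ≠ 0) :
    (Function.support fun i => ord i f).Finite ∧ ∑ᶠ i, ord i f = 0 := by
  by_cases hh : Transcendental k f
  · have := hfin f hh
    obtain ⟨h1, h2⟩ := H.finsum_max_ord hh
    obtain ⟨h3, h4⟩ := H.finsum_max_neg_ord hh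
    refine ⟨(h1.union h3).subset fun i hi => (lt_or_gt_of_ne hi).symm, ?_⟩
    have hsplit : (fun i => ord i f) = fun i => max (ord i f) 0 - max (-ord i f) 0 := by
      ext i
      rcases le_total (ord i f) 0 with h | h
      · rw [max_eq_right h, max_eq_left (by omega)]
        omega
      · rw [max_eq_left h, max_eq_right (by omega)]
        omega
    rw [hsplit, finsum_sub_distrib, h2, h4, sub_self]
    · refine h1.subset fun i hi => ?_
      by_contra hle
      exact hi (max_eq_right (not_lt.mp hle))
    · refine h3.subset fun i hi => ?_
      by_contra hle
      rw [Set.mem_ofPred_eq, not_lt] at hle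
      exact hi (max_eq_right (by omega))
  · obtain ⟨c, rfl⟩ := exists_algebraMap_eq_of_isAlgebraic (not_not.mp hh)
    have hc : c ≠ 0 := by
      rintro rfl
      simp at hf
    simp [H.ord_algebraMap _ hc]

/-- The degree of the line bundle generated by two functions is the degree of their quotient. -/
theorem finsum_neg_min_ord (H : IsPlaceSystem k A ord) [IsAlgClosed k] [CharZero k]
    (hfin : ∀ h : K, Transcendental k h → FiniteDimensional (IntermediateField.adjoin k {h}) K)
    {f g : K} (hf : f ≠ 0) (hg : g ≠ 0) (hfg : Transcendental k (f / g)) :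
    (Function.support fun i => -min (ord i f) (ord i g)).Finite ∧
      ∑ᶠ i, -min (ord i f) (ord i g) =
        Module.finrank (IntermediateField.adjoin k {f / g}) K := by
  have := hfin _ hfg
  obtain ⟨h1, h2⟩ := H.finsum_max_neg_ord hfg
  obtain ⟨h3, h4⟩ := H.finsum_ord hfin hg
  -- The first term counts the poles of `f / g`; the second sums to zero over all places.
  have hsplit : (fun i => -min (ord i f) (ord i g)) =
      fun i => max (-ord i (f / g)) 0 - ord i g := by
    ext i
    rw [H.ord_div i hf hg]
    omega
  have hs1 : (Function.support fun i => max (-ord i (f / g)) 0).Finite := by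
    refine h1.subset fun i hi => ?_
    by_contra hle
    rw [Set.mem_ofPred_eq, not_lt] at hle
    exact hi (max_eq_right (by omega))
  rw [hsplit]
  refine ⟨(hs1.union h3).subset (Function.support_sub _ _), ?_⟩
  rw [finsum_sub_distrib hs1 h3, h2, h4, sub_zero]

end IsPlaceSystem

end PlaneCurve

namespace PlaneCurve

/-! ### Étale algebras over a polynomial ring in one variable. -/

section EtaleAlgebra

variable {T B : Type*} [CommRing T] [CommRing B] [Algebra T B]
  [Algebra.Etale T B]

/-- Unramifiedness: the prime below generates the maximal ideal of the local ring above, and that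
prime has one generator. -/
theorem isPrincipal_maximalIdeal_of_etale [IsPrincipalIdealRing T] (q : Ideal B) [q.IsPrime] :
    (IsLocalRing.maximalIdeal (Localization.AtPrime q)).IsPrincipal := by
  have hq : Algebra.IsUnramifiedAt T q :=
    Algebra.FormallyUnramified.comp T B (Localization.AtPrime q)
  let : Algebra (Localization.AtPrime (q.under T)) (Localization.AtPrime q) :=
    (Localization.localRingHom (q.under T) q (algebraMap T B) rfl).toAlgebra
  have : Localization.AtPrime.IsLiesOverAlgebra (q.under T) q := ⟨rfl⟩
  rw [← ((Algebra.isUnramifiedAt_iff_map_eq T (q.under T) q).1 hq).2]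
  obtain ⟨a, ha⟩ := (IsPrincipalIdealRing.principal (q.under T)).principal
  rw [show q.under T = Ideal.span {a} from ha, Ideal.map_span, Set.image_singleton]
  infer_instance

theorem algebraMap_injective_of_etale [IsDomain T] [IsDomain B] :
    Function.Injective (algebraMap T B) := by
  have : Module.Flat T B := inferInstance
  exact FaithfulSMul.algebraMap_injective T B

/-- Over the field `FractionRing T`, the field `K` is formally unramified and essentially of finite
type, and such an algebra over a field is finite. -/
theorem isAlgebraic_of_etale [IsDomain T] [IsDomain B] (K : Type*) [Field K] [Algebra B K] [IsFractionRing B K]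
    [Algebra T K] [IsScalarTower T B K] : Algebra.IsAlgebraic T K := by
  have hinj : Function.Injective (algebraMap T K) := by
    rw [IsScalarTower.algebraMap_eq T B K]
    exact (IsFractionRing.injective B K).comp algebraMap_injective_of_etale
  have : FaithfulSMul T K := (faithfulSMul_iff_algebraMap_injective T K).2 hinj
  let := FractionRing.liftAlgebra T K
  have : IsScalarTower T (FractionRing T) K := inferInstance
  have : Algebra.FormallyUnramified B K := .of_isLocalization (nonZeroDivisors B)
  have : Algebra.FormallyUnramified T K := .comp T B K
  have : Algebra.FormallyUnramified (FractionRing T) K := .of_restrictScalars T _ _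
  have : Algebra.EssFiniteType B K := .of_isLocalization K (nonZeroDivisors B)
  have : Algebra.EssFiniteType T K := .comp T B K
  have : Algebra.EssFiniteType (FractionRing T) K := .of_comp T _ _
  have : Module.Finite (FractionRing T) K := Algebra.FormallyUnramified.finite_of_free _ _
  exact (IsFractionRing.comap_isAlgebraic_iff (A := T) (K := FractionRing T) (C := K)).2 inferInstance

end EtaleAlgebra

theorem isPrincipalIdealRing_mvPolynomial_fin_one (k : Type*) [Field k] :
    IsPrincipalIdealRing (MvPolynomial (Fin 1) k) :=
  .of_surjective (MvPolynomial.uniqueAlgEquiv k (Fin 1)).symm.toRingHom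
    (MvPolynomial.uniqueAlgEquiv k (Fin 1)).symm.surjective

section CurveAlgebra

variable {k B K : Type} [Field k] [CommRing B] [Algebra k B]
  [Field K] [Algebra B K] [IsFractionRing B K] [Algebra k K] [IsScalarTower k B K]

theorem trdeg_le_one_of_etale [IsDomain B] {g : MvPolynomial (Fin 1) k →ₐ[k] B} (hg : g.toRingHom.Etale) :
    Algebra.trdeg k K ≤ 1 := by
  algebraize [g.toRingHom]
  let : Algebra (MvPolynomial (Fin 1) k) K := ((algebraMap B K).comp g.toRingHom).toAlgebra
  have : IsScalarTower (MvPolynomial (Fin 1) k) B K := .of_algebraMap_eq' rfl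
  have : Algebra.IsAlgebraic (MvPolynomial (Fin 1) k) K := isAlgebraic_of_etale (B := B) K
  have hinj : Function.Injective (algebraMap (MvPolynomial (Fin 1) k) K) := by
    rw [IsScalarTower.algebraMap_eq _ B K]
    exact (IsFractionRing.injective B K).comp algebraMap_injective_of_etale
  have : FaithfulSMul (MvPolynomial (Fin 1) k) K :=
    (faithfulSMul_iff_algebraMap_injective _ K).2 hinj
  have : IsScalarTower k (MvPolynomial (Fin 1) k) K := .of_algebraMap_eq' <| by
    rw [IsScalarTower.algebraMap_eq k B K, ← g.comp_algebraMap]; rfl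
  rw [← trdeg_add_eq k (MvPolynomial (Fin 1) k), MvPolynomial.trdeg_of_isDomain,
    trdeg_eq_zero]
  simp

theorem essFiniteType_of_etale (K : Type) [Field K] [Algebra B K] [IsFractionRing B K] [Algebra k K]
    [IsScalarTower k B K] {g : MvPolynomial (Fin 1) k →ₐ[k] B} (hg : g.toRingHom.Etale) :
    Algebra.EssFiniteType k K := by
  algebraize [g.toRingHom]
  have : IsScalarTower k (MvPolynomial (Fin 1) k) B := .of_algebraMap_eq' g.comp_algebraMap.symm
  have : Algebra.FiniteType (MvPolynomial (Fin 1) k) B := inferInstance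
  have : Algebra.FiniteType k B := .trans (S := MvPolynomial (Fin 1) k) inferInstance this
  have : Algebra.EssFiniteType B K := .of_isLocalization K (nonZeroDivisors B)
  exact .comp k B K

end CurveAlgebra

/-- A single transcendental element is already a transcendence basis, and an algebraic extension
essentially of finite type is finite. -/
theorem finiteDimensional_adjoin_of_trdeg_le_one {k K : Type*} [Field k] [Field K] [Algebra k K]
    [Algebra.EssFiniteType k K] (h : Algebra.trdeg k K ≤ 1) {x : K} (hx : Transcendental k x) :
    FiniteDimensional (IntermediateField.adjoin k {x}) K := by
  have hb : IsTranscendenceBasis k fun _ : Unit => x :=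
    ((algebraicIndependent_singleton_iff ()).2 hx).isTranscendenceBasis_of_lift_trdeg_le_of_finite
      (by simpa using h)
  have := hb.isAlgebraic_field
  rw [Set.range_const] at this
  have : Algebra.EssFiniteType (IntermediateField.adjoin k {x}) K := .of_comp k _ _
  exact Algebra.finite_of_essFiniteType_of_isAlgebraic

theorem not_algebraicIndependent_of_trdeg_le_one {k K : Type*} [Field k] [Field K] [Algebra k K]
    (h : Algebra.trdeg k K ≤ 1) (w : Fin 2 → K) : ¬ AlgebraicIndependent k w := by
  intro hw
  have h2 := hw.lift_cardinalMk_le_trdeg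
  simp at h2
  have := h2.trans h
  norm_num at this

end PlaneCurve

namespace PlaneCurve

/-! ### Local rings and function field of a smooth curve. -/

variable (C : Scheme.{0}) [C.Over (Spec (.of ℂ))]

/-- The structure map `ℂ → Γ(C, U)`. -/
noncomputable def scalar (U : C.Opens) : ℂ →+* Γ(C, U) :=
  ((C ↘ Spec (.of ℂ)).appLE ⊤ U le_top).hom.comp (Scheme.ΓSpecIso (.of ℂ)).inv.hom

/-- The structure map `ℂ → 𝒪_{C, x}`. -/
noncomputable def stalkScalar (x : C) : CommRingCat.of ℂ ⟶ C.presheaf.stalk x :=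
  (Scheme.ΓSpecIso (.of ℂ)).inv ≫ (C ↘ Spec (.of ℂ)).appTop ≫ C.presheaf.germ ⊤ x trivial

theorem germ_scalar_eq_stalkScalar {U : C.Opens} {x : C} (hx : x ∈ U) (c : ℂ) :
    C.presheaf.germ U x hx (scalar C U c) = stalkScalar C x c := by
  simp only [scalar, Scheme.Hom.appLE, RingHom.comp_apply, CommRingCat.hom_comp]
  exact C.presheaf.germ_res_apply (homOfLE le_top) _ _ _

theorem fromSpecStalk_comp_over (x : C) :
    C.fromSpecStalk x ≫ (C ↘ Spec (.of ℂ)) = Spec.map (stalkScalar C x) := by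
  have h : C.toSpecΓ ≫ Spec.map ((Scheme.ΓSpecIso (.of ℂ)).inv ≫ (C ↘ Spec (.of ℂ)).appTop) =
      C ↘ Spec (.of ℂ) := by
    rw [Spec.map_comp, ← Scheme.toSpecΓ_naturality_assoc, ← SpecMap_ΓSpecIso_hom, ← Spec.map_comp,
      Iso.inv_hom_id, Spec.map_id, Category.comp_id]
  rw [stalkScalar, ← Category.assoc, Spec.map_comp, ← Scheme.fromSpecStalk_toSpecΓ, Category.assoc, h]

variable [LinearSeries.IsSmoothProjectiveCurve C]

theorem germ_scalar {U : C.Opens} [Nonempty U] (c : ℂ) :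
    C.germToFunctionField U (scalar C U c) = algebraMap ℂ C.functionField c := by
  simp only [scalar, Scheme.Hom.appLE, RingHom.comp_apply, CommRingCat.hom_comp]
  exact C.presheaf.germ_res_apply (homOfLE le_top) _ _ _

/-- A smooth morphism of relative dimension one is locally étale over an affine line. The open of
the base that comes with the chart is everything, since `Spec ℂ` is one point. -/
theorem exists_etale_chart (x : C) : ∃ U : C.Opens, IsAffineOpen U ∧ x ∈ U ∧
    ∃ g : MvPolynomial (Fin 1) ℂ →+* Γ(C, U), g.comp MvPolynomial.C = scalar C U ∧ g.Etale := by
  obtain ⟨W, hW, U, hU, hx, e, h⟩ :=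
    SmoothOfRelativeDimension.exists_isStandardSmoothOfRelativeDimension (n := 1)
      (f := C ↘ Spec (.of ℂ)) x
  have hW : W = ⊤ := by
    refine top_le_iff.1 fun y _ => ?_
    have : Subsingleton (Spec (.of ℂ)) := inferInstanceAs (Subsingleton (PrimeSpectrum ℂ))
    rw [Subsingleton.elim y ((C ↘ Spec (.of ℂ)) x)]
    exact e hx
  subst hW
  refine ⟨U, hU, hx, RingHom.IsStandardSmoothOfRelativeDimension.exists_etale_mvPolynomial ?_⟩
  unfold scalar
  have := RingHom.isStandardSmoothOfRelativeDimension_respectsIso (n := 1)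
  exact this.2 _ (Scheme.ΓSpecIso (.of ℂ)).symm.commRingCatIsoToRingEquiv h

theorem algebraMap_stalkScalar (x : C) (c : ℂ) :
    algebraMap (C.presheaf.stalk x) C.functionField (stalkScalar C x c) =
      algebraMap ℂ C.functionField c := by
  have : Nonempty (⊤ : C.Opens) := ⟨⟨x, trivial⟩⟩
  exact C.algebraMap_germ_eq_germToFunctionField (U := ⊤) (x := x) trivial _

variable {C} in
-- The residue field at a closed point is `ℂ`; the scalar `c` is the value of `a` at `x`.
theorem exists_sub_stalkScalar_mem {x : C} (hx : IsClosed {x}) (a : C.presheaf.stalk x) :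
    ∃ c : ℂ, a - stalkScalar C x c ∈ IsLocalRing.maximalIdeal (C.presheaf.stalk x) := by
  let e := residueFieldIsoBase (C ↘ Spec (.of ℂ)) x hx
  have he : e.inv = stalkScalar C x ≫ C.residue x := by
    apply Spec.map_injective
    rw [SpecMap_residueFieldIsoBase_inv, Spec.map_comp, ← fromSpecStalk_comp_over]
    simp [Scheme.fromSpecResidueField]
  refine ⟨e.hom (C.residue x a), ?_⟩
  rw [← IsLocalRing.residue_eq_zero_iff, map_sub, sub_eq_zero]
  have := congr($he (e.hom (C.residue x a)))
  simp only [Iso.hom_inv_id_apply] at this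
  exact this

variable {C} in
-- The maximal ideal is principal because `C` is étale over a line near `x`. The stalk is not a
-- field: otherwise the coordinate of the étale chart would equal its value at `x`, against
-- injectivity of the chart map.
theorem isDiscreteValuationRing_stalk {x : C} (hx : IsClosed {x}) :
    IsDiscreteValuationRing (C.presheaf.stalk x) := by
  obtain ⟨U, hU, hxU, g, hg, het⟩ := exists_etale_chart C x
  have : Nonempty U := ⟨⟨x, hxU⟩⟩
  have hinj : Function.Injective g := by
    algebraize [g]
    exact algebraMap_injective_of_etale
  have hnf : ¬ IsField (C.presheaf.stalk x) := by
    intro hf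
    obtain ⟨c, hc⟩ := exists_sub_stalkScalar_mem hx
      (C.presheaf.germ U x hxU (g (MvPolynomial.X 0)))
    rw [IsLocalRing.isField_iff_maximalIdeal_eq.1 hf, Ideal.mem_bot, sub_eq_zero,
      ← germ_scalar_eq_stalkScalar C hxU, ← hg] at hc
    have := hinj (germ_injective_of_isIntegral _ x hxU hc)
    simpa using congrArg MvPolynomial.totalDegree this
  have : (IsLocalRing.maximalIdeal (C.presheaf.stalk x)).IsPrincipal := by
    let := C.presheaf.algebra_section_stalk ⟨x, hxU⟩
    have hloc := hU.isLocalization_stalk ⟨x, hxU⟩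
    let q := (hU.primeIdealOf ⟨x, hxU⟩).asIdeal
    have hp : (IsLocalRing.maximalIdeal (Localization.AtPrime q)).IsPrincipal := by
      have := isPrincipalIdealRing_mvPolynomial_fin_one ℂ
      algebraize [g]
      exact isPrincipal_maximalIdeal_of_etale (T := MvPolynomial (Fin 1) ℂ) q
    obtain ⟨t, ht⟩ := hp
    let e := IsLocalization.algEquiv q.primeCompl (Localization.AtPrime q) (C.presheaf.stalk x)
    refine ⟨e t, ?_⟩
    rw [← IsLocalization.AtPrime.map_eq_maximalIdeal q, ← e.toAlgHom.comp_algebraMap,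
      ← Ideal.map_map, IsLocalization.AtPrime.map_eq_maximalIdeal q, ht]
    exact (Ideal.map_span _ _).trans (by simp)
  have hN : IsNoetherianRing (C.presheaf.stalk x) := inferInstance
  exact ((IsDiscreteValuationRing.TFAE _ hnf).out 0 4).2 this

theorem trdeg_functionField_le_one : Algebra.trdeg ℂ C.functionField ≤ 1 := by
  obtain ⟨U, hU, hxU, g, hg, het⟩ := exists_etale_chart C (genericPoint C)
  have : Nonempty U := ⟨⟨_, hxU⟩⟩
  have := functionField_isFractionRing_of_isAffineOpen C U hU
  let : Algebra ℂ Γ(C, U) := (scalar C U).toAlgebra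
  have : IsScalarTower ℂ Γ(C, U) C.functionField :=
    .of_algebraMap_eq fun c => (germ_scalar C c).symm
  exact trdeg_le_one_of_etale (B := Γ(C, U)) (g := { g with commutes' := fun c => congr($hg c) }) het

theorem essFiniteType_functionField : Algebra.EssFiniteType ℂ C.functionField := by
  obtain ⟨U, hU, hxU, g, hg, het⟩ := exists_etale_chart C (genericPoint C)
  have : Nonempty U := ⟨⟨_, hxU⟩⟩
  have := functionField_isFractionRing_of_isAffineOpen C U hU
  let : Algebra ℂ Γ(C, U) := (scalar C U).toAlgebra
  have : IsScalarTower ℂ Γ(C, U) C.functionField :=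
    .of_algebraMap_eq fun c => (germ_scalar C c).symm
  exact essFiniteType_of_etale (B := Γ(C, U)) _ (g := { g with commutes' := fun c => congr($hg c) }) het

end PlaneCurve

namespace PlaneCurve

/-! ### Closed points of the curve as places of its function field. -/

variable {C : Scheme.{0}} [C.Over (Spec (.of ℂ))] [LinearSeries.IsSmoothProjectiveCurve C]

theorem coheight_eq_one {x : C} (hx : IsClosed {x}) : Order.coheight x = 1 := by
  have := isDiscreteValuationRing_stalk hx
  have h := IsDiscreteValuationRing.ringKrullDim_eq_one (C.presheaf.stalk x)
  rw [ringKrullDim_stalk_eq_coheight] at h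
  exact_mod_cast h

theorem ord_nonneg_iff {x : C} (hx : IsClosed {x}) {f : C.functionField} (hf : f ≠ 0) :
    0 ≤ C.ord f x ↔ f ∈ (algebraMap (C.presheaf.stalk x) C.functionField).range := by
  have := isDiscreteValuationRing_stalk hx
  rw [Scheme.le_ord_iff (coheight_eq_one hx) hf, ofAdd_zero, WithZero.coe_one, Scheme.ordHom,
    Ring.ordFrac_eq_valuation_inv, one_le_inv₀ (by simpa [WithZero.pos_iff_ne_zero])]
  constructor
  · exact IsDiscreteValuationRing.exists_lift_of_le_one
  · rintro ⟨a, rfl⟩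
    exact IsDedekindDomain.HeightOneSpectrum.valuation_le_one _ a

theorem exists_ord_eq_one {x : C} (hx : IsClosed {x}) :
    ∃ t : C.functionField, t ≠ 0 ∧ C.ord t x = 1 := by
  have := isDiscreteValuationRing_stalk hx
  obtain ⟨t, ht⟩ := IsDiscreteValuationRing.exists_irreducible (C.presheaf.stalk x)
  have ht0 : algebraMap (C.presheaf.stalk x) C.functionField t ≠ 0 := by
    simpa using ht.ne_zero
  refine ⟨_, ht0, ?_⟩
  rw [Scheme.ord_eq_iff (coheight_eq_one hx) ht0]
  exact Ring.ordFrac_irreducible ht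

/-- The local ring of a closed point, as a valuation ring of the function field. -/
noncomputable def placeRing (x : {x : C // IsClosed {x}}) : ValuationSubring C.functionField :=
  { (algebraMap (C.presheaf.stalk x.1) C.functionField).range with
    mem_or_inv_mem' := fun f => by
      have := isDiscreteValuationRing_stalk x.2
      exact ValuationRing.isInteger_or_isInteger (C.presheaf.stalk x.1) f }

section ValuativeCriterion

variable (B : ValuationSubring C.functionField)

/-- The generic point of `C` and a valuation ring of `K(C)` over `ℂ`, as a valuative square. -/
noncomputable def valuativeSquare (hB : ∀ c : ℂ, algebraMap ℂ C.functionField c ∈ B) :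
    ValuativeCommSq (C ↘ Spec (.of ℂ)) where
  R := B
  K := C.functionField
  i₁ := C.fromSpecStalk (genericPoint C)
  i₂ := Spec.map (CommRingCat.ofHom ((algebraMap ℂ C.functionField).codRestrict B.toSubring hB))
  commSq := ⟨by
    rw [fromSpecStalk_comp_over, ← Spec.map_comp]
    rfl⟩

/-- The morphism `Spec B ⟶ C` given by an inclusion `𝒪_{C, x} ⊆ B`. -/
noncomputable def specToCurve {x : C}
    (h : ∀ a, algebraMap (C.presheaf.stalk x) C.functionField a ∈ B) : Spec (.of B) ⟶ C :=
  Spec.map (CommRingCat.ofHom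
    ((algebraMap (C.presheaf.stalk x) C.functionField).codRestrict B.toSubring h)) ≫
      C.fromSpecStalk x

theorem specToCurve_lift {x : C}
    (h : ∀ a, algebraMap (C.presheaf.stalk x) C.functionField a ∈ B) :
    Spec.map (CommRingCat.ofHom (algebraMap B C.functionField)) ≫ specToCurve B h =
      C.fromSpecStalk (genericPoint C) := by
  rw [specToCurve, ← Spec.map_comp_assoc,
    ← C.SpecMap_stalkSpecializes_fromSpecStalk ((genericPoint_spec C).specializes trivial)]
  rfl

theorem specToCurve_comp (hB : ∀ c : ℂ, algebraMap ℂ C.functionField c ∈ B) {x : C}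
    (h : ∀ a, algebraMap (C.presheaf.stalk x) C.functionField a ∈ B) :
    specToCurve B h ≫ (C ↘ Spec (.of ℂ)) = (valuativeSquare B hB).i₂ := by
  rw [specToCurve, Category.assoc, fromSpecStalk_comp_over, ← Spec.map_comp]
  congr 1
  ext c
  exact congrArg (Subtype.val) (Subtype.ext (algebraMap_stalkScalar C x c) :
    (⟨_, h (stalkScalar C x c)⟩ : B) = ⟨_, hB c⟩)

theorem specToCurve_closedPoint {x : {x : C // IsClosed {x}}} (hx : placeRing x = B)
    (h : ∀ a, algebraMap (C.presheaf.stalk x.1) C.functionField a ∈ B) :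
    specToCurve B h (IsLocalRing.closedPoint B) = x := by
  have : IsLocalHom
      ((algebraMap (C.presheaf.stalk x.1) C.functionField).codRestrict B.toSubring h) := by
    refine ⟨fun a ha => ?_⟩
    obtain ⟨⟨b, hbB⟩, hb⟩ := ha.exists_right_inv
    rw [← hx] at hbB
    obtain ⟨b, rfl⟩ := hbB
    refine .of_mul_eq_one b (IsFractionRing.injective (C.presheaf.stalk x.1) C.functionField ?_)
    rw [map_mul, map_one]
    exact congrArg Subtype.val hb
  have : IsLocalRing B.toSubring := inferInstanceAs (IsLocalRing B)
  exact (congrArg (C.fromSpecStalk x.1) (IsLocalRing.comap_closedPoint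
    ((algebraMap (C.presheaf.stalk x.1) C.functionField).codRestrict B.toSubring h))).trans
    Scheme.fromSpecStalk_closedPoint

end ValuativeCriterion

theorem algebraMap_mem_placeRing (x : {x : C // IsClosed {x}}) (c : ℂ) :
    algebraMap ℂ C.functionField c ∈ placeRing x :=
  ⟨stalkScalar C x.1 c, algebraMap_stalkScalar C x.1 c⟩

/-- Separatedness: two closed points with the same local ring in `K(C)` give two lifts of one
valuative square, and the closed point of the valuation ring goes to each of them. -/
theorem placeRing_injective : Function.Injective (placeRing (C := C)) := by
  intro x y h
  have hsub := IsSeparated.valuativeCriterion (C ↘ Spec (.of ℂ))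
    (valuativeSquare (placeRing x) (algebraMap_mem_placeRing x))
  have := congrArg CommSq.LiftStruct.l (hsub.elim
    ⟨specToCurve (placeRing x) fun a => ⟨a, rfl⟩, specToCurve_lift _ _,
      specToCurve_comp _ (algebraMap_mem_placeRing x) _⟩
    ⟨specToCurve (placeRing x) (x := y.1) (fun a => h ▸ ⟨a, rfl⟩), specToCurve_lift _ _,
      specToCurve_comp _ (algebraMap_mem_placeRing x) _⟩)
  have := congrArg (fun l : Spec (.of (placeRing x)) ⟶ C =>
    l (IsLocalRing.closedPoint (placeRing x))) this
  exact Subtype.ext <| (specToCurve_closedPoint _ rfl _).symm.trans <|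
    this.trans (specToCurve_closedPoint _ h.symm _)

variable (C) in
theorem compactSpace_curve : CompactSpace C := by
  have : QuasiCompact (C ↘ Spec (.of ℂ)) := inferInstance
  exact QuasiCompact.compactSpace_of_compactSpace (C ↘ Spec (.of ℂ))

/-- Properness: the valuative square of `B` has a lift, and the local ring at the image `y` of the
closed point is contained in `B`. -/
theorem exists_placeRing_le (B : ValuationSubring C.functionField)
    (hB : ∀ c : ℂ, algebraMap ℂ C.functionField c ∈ B) : ∃ x, placeRing (C := C) x ≤ B := by
  have hex : ValuativeCriterion.Existence (C ↘ Spec (.of ℂ)) := by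
    have : UniversallyClosed (C ↘ Spec (.of ℂ)) := inferInstance
    rw [UniversallyClosed.eq_valuativeCriterion] at this
    exact this.1
  obtain ⟨⟨l, hl, -⟩⟩ := hex (valuativeSquare B hB)
  change Spec.map (CommRingCat.ofHom (algebraMap B C.functionField)) ≫ l =
    C.fromSpecStalk (genericPoint C) at hl
  let l' : Spec (.of B) ⟶ C := l
  let y : C := l' (IsLocalRing.closedPoint B)
  have hy : ∀ a, algebraMap (C.presheaf.stalk y) C.functionField a ∈ B := by
    have h : Scheme.stalkClosedPointTo l' ≫ CommRingCat.ofHom (algebraMap B C.functionField) =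
        C.presheaf.stalkSpecializes ((genericPoint_spec C).specializes trivial) := by
      apply Spec.map_injective
      rw [← cancel_mono (C.fromSpecStalk _), Scheme.SpecMap_stalkSpecializes_fromSpecStalk,
        Spec.map_comp, Category.assoc, Scheme.Spec_stalkClosedPointTo_fromSpecStalk]
      exact hl
    intro a
    have ha := congr($h a)
    exact ha ▸ (Scheme.stalkClosedPointTo l' a).2
  have := compactSpace_curve C
  -- The point `y` need not be closed, since `B = ⊤` is allowed. A closed specialization `x` has a
  -- smaller local ring inside `K(C)`.
  obtain ⟨x, hxy, hx⟩ := isClosed_closure.exists_closed_singleton (S := closure {y})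
    (closure_nonempty_iff.2 ⟨y, rfl⟩)
  refine ⟨⟨x, hx⟩, ?_⟩
  rintro _ ⟨a, rfl⟩
  have hs : y ⤳ x := specializes_iff_mem_closure.2 hxy
  have := hy (C.presheaf.stalkSpecializes hs a)
  convert this using 1
  have h2 := C.presheaf.stalkSpecializes_comp ((genericPoint_spec C).specializes trivial) hs
  exact congr($h2.symm a)

/-- Dimension one makes `placeRing x` maximal among proper valuation rings, which turns the
inclusion of `exists_placeRing_le` into an equality. -/
theorem krullDimLE_one_placeRing (x : {x : C // IsClosed {x}}) :
    Ring.KrullDimLE 1 (placeRing x) := by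
  have := isDiscreteValuationRing_stalk x.2
  let e : C.presheaf.stalk x.1 ≃+* placeRing x := RingEquiv.ofBijective
    ((algebraMap (C.presheaf.stalk x.1) C.functionField).codRestrict (placeRing x).toSubring
      fun a => ⟨a, rfl⟩)
    ⟨fun a b h => IsFractionRing.injective (C.presheaf.stalk x.1) C.functionField
      (congrArg Subtype.val h), fun ⟨_, a, ha⟩ => ⟨a, Subtype.ext ha⟩⟩
  rw [Ring.krullDimLE_iff, ← ringKrullDim_eq_of_ringEquiv e,
    IsDiscreteValuationRing.ringKrullDim_eq_one]
  rfl

variable (C) in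
theorem isPlaceSystem_placeRing :
    IsPlaceSystem ℂ (placeRing (C := C)) fun x f => C.ord f x.1 where
  ord_mul x _ _ hf hg := Scheme.ord_mul hf hg
  ord_nonneg_iff x _ hf := ord_nonneg_iff x.2 hf
  exists_ord_eq_one x := exists_ord_eq_one x.2
  algebraMap_mem := algebraMap_mem_placeRing
  injective := placeRing_injective
  surjective B hB hne := by
    obtain ⟨x, hx⟩ := exists_placeRing_le B hB
    have := krullDimLE_one_placeRing x
    exact ⟨x, ValuationSubring.eq_of_le_of_ne_top _ hx hne⟩

theorem finiteDimensional_functionField {h : C.functionField} (hh : Transcendental ℂ h) :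
    FiniteDimensional (IntermediateField.adjoin ℂ {h}) C.functionField :=
  have := essFiniteType_functionField C
  finiteDimensional_adjoin_of_trdeg_le_one (trdeg_functionField_le_one C) hh

end PlaneCurve

open HomogeneousLocalization

namespace PlaneCurve

/-! ### Affine charts of the projective plane. -/

section Chart

attribute [local instance] MvPolynomial.gradedAlgebra

/-- The grading of `k[X₀, X₁, X₂]` by degree. -/
abbrev planeGrading (k : Type*) [Field k] : ℕ → Submodule k (MvPolynomial (Fin 3) k) :=
  MvPolynomial.homogeneousSubmodule (Fin 3) k

variable {k : Type*} [Field k] (j : Fin 3) (a : Fin 2 → k)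

theorem X_mem_planeGrading (k : Type*) [Field k] (i : Fin 3) : MvPolynomial.X i ∈ planeGrading k 1 :=
  MvPolynomial.isHomogeneous_X k i

/-- The affine coordinates `Xᵢ / Xⱼ - aᵢ` with `i ≠ j` on the chart `Xⱼ ≠ 0` of the plane. -/
noncomputable def chartCoordinates :
    MvPolynomial (Fin 2) k →+* Away (planeGrading k) (MvPolynomial.X j) :=
  let c : k →+* Away (planeGrading k) (MvPolynomial.X j) :=
    (fromZeroRingHom (planeGrading k) _).comp (algebraMap k (planeGrading k 0))
  MvPolynomial.eval₂Hom c fun i =>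
    Away.mk (planeGrading k) (X_mem_planeGrading k j) 1 (MvPolynomial.X (j.succAbove i))
      (X_mem_planeGrading k _) - c (a i)

theorem aeval_mul_of_isHomogeneous {σ S : Type*} [CommRing S] [Algebra k S] {p : MvPolynomial σ k}
    {n : ℕ} (hp : p.IsHomogeneous n) (c : S) (g : σ → S) :
    MvPolynomial.aeval (fun i => c * g i) p = c ^ n * MvPolynomial.aeval g p := by
  rw [MvPolynomial.aeval_def, MvPolynomial.aeval_def, MvPolynomial.eval₂_eq, MvPolynomial.eval₂_eq,
    Finset.mul_sum]
  refine Finset.sum_congr rfl fun d hd => ?_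
  rw [Finset.prod_congr rfl fun i _ => mul_pow c (g i) (d i), Finset.prod_mul_distrib,
    Finset.prod_pow_eq_pow_sum, ← hp.degree_eq_sum_deg_support hd]
  ring

theorem val_fromZeroRingHom_algebraMap (t : MvPolynomial (Fin 3) k) (c : k) :
    (fromZeroRingHom (planeGrading k) (Submonoid.powers t) (algebraMap k (planeGrading k 0) c)).val =
      algebraMap k (Localization.Away t) c := by
  rw [IsScalarTower.algebraMap_apply k (MvPolynomial (Fin 3) k) (Localization.Away t)]
  exact Localization.mk_one_eq_algebraMap _

theorem lift_mk'_mul {A P : Type*} [CommRing A] [CommRing P] {t : A} {g : A →+* P}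
    (ht : IsUnit (g t)) (b : A) :
    IsLocalization.Away.lift (S := Localization.Away t) t ht
      (IsLocalization.mk' _ b ⟨t, Submonoid.mem_powers t⟩) * g t = g b := by
  rw [← IsLocalization.Away.lift_eq (S := Localization.Away t) t ht t, ← map_mul,
    ← IsLocalization.Away.lift_eq (S := Localization.Away t) t ht b]
  exact congrArg _ (IsLocalization.mk'_spec _ b ⟨t, Submonoid.mem_powers t⟩)

/-- The degree-zero part embeds in the full localization, where the coordinates are honest
fractions; identities on the chart are checked there. -/
theorem algebraMap_comp_chartCoordinates :
    (algebraMap (Away (planeGrading k) (MvPolynomial.X j))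
      (Localization.Away (MvPolynomial.X j : MvPolynomial (Fin 3) k))).comp (chartCoordinates j a) =
    (MvPolynomial.aeval (R := k) fun i =>
      (IsLocalization.mk' (M := Submonoid.powers (MvPolynomial.X j)) _
        (MvPolynomial.X (R := k) (j.succAbove i)) ⟨MvPolynomial.X j, Submonoid.mem_powers _⟩ :
        Localization.Away (MvPolynomial.X j : MvPolynomial (Fin 3) k)) -
        algebraMap k _ (a i)).toRingHom := by
  refine MvPolynomial.ringHom_ext (fun c => ?_) fun i => ?_
  · simp [chartCoordinates, val_fromZeroRingHom_algebraMap]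
  · simp [chartCoordinates, val_fromZeroRingHom_algebraMap, Localization.mk_eq_mk']

variable {j} in
/-- The evaluation on the chart `Xⱼ ≠ 0` at a point `[s₀ : s₁ : s₂]` with `sⱼ ≠ 0`. -/
noncomputable def evalAway {K : Type*} [Field K] [Algebra k K] {s : Fin 3 → K} (hs : s j ≠ 0) :
    Away (planeGrading k) (MvPolynomial.X j) →+* K :=
  (IsLocalization.Away.lift (S := Localization.Away (MvPolynomial.X j : MvPolynomial (Fin 3) k))
    (MvPolynomial.X j) (g := (MvPolynomial.aeval (R := k) s).toRingHom)
    (by simpa using hs)).comp (algebraMap _ _)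

theorem evalAway_comp_chartCoordinates {K : Type*} [Field K] [Algebra k K] {s : Fin 3 → K}
    (hs : s j ≠ 0) : (evalAway hs).comp (chartCoordinates j a) =
      (MvPolynomial.aeval (R := k) fun i => s (j.succAbove i) / s j - algebraMap k K (a i)).toRingHom := by
  rw [evalAway, RingHom.comp_assoc, algebraMap_comp_chartCoordinates]
  refine MvPolynomial.ringHom_ext (fun c => ?_) fun i => ?_
  · simp [IsScalarTower.algebraMap_apply k (MvPolynomial (Fin 3) k) (Localization.Away _)]
  · have h := lift_mk'_mul (t := (MvPolynomial.X j : MvPolynomial (Fin 3) k))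
      (g := (MvPolynomial.aeval (R := k) s).toRingHom) (by simpa using hs)
      (MvPolynomial.X (j.succAbove i))
    simp only [AlgHom.toRingHom_eq_coe, RingHom.coe_coe, MvPolynomial.aeval_X] at h
    simp [IsScalarTower.algebraMap_apply k (MvPolynomial (Fin 3) k) (Localization.Away _),
      eq_div_iff hs, h]

/-- The inverse is dehomogenization, `Xⱼ ↦ 1` with the other variables shifted by `a`. Surjectivity
uses `Xⱼ ^ n * p(X / Xⱼ) = p(X)` for `p` homogeneous of degree `n`. -/
theorem chartCoordinates_bijective : Function.Bijective (chartCoordinates j a) := by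
  constructor
  · let g : MvPolynomial (Fin 3) k →+* MvPolynomial (Fin 2) k := (MvPolynomial.aeval (R := k)
      (j.insertNth 1 fun i => MvPolynomial.X i + MvPolynomial.C (a i))).toRingHom
    let l := IsLocalization.Away.lift
      (S := Localization.Away (MvPolynomial.X j : MvPolynomial (Fin 3) k))
      (MvPolynomial.X j) (g := g) (by simp [g])
    have hl : (l.comp (algebraMap _ _)).comp (chartCoordinates j a) = RingHom.id _ := by
      rw [RingHom.comp_assoc, algebraMap_comp_chartCoordinates]
      refine MvPolynomial.ringHom_ext (fun c => ?_) fun i => ?_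
      · simp [IsScalarTower.algebraMap_apply k (MvPolynomial (Fin 3) k) (Localization.Away _), l, g]
      · have h := lift_mk'_mul (t := (MvPolynomial.X j : MvPolynomial (Fin 3) k))
          (g := g) (by simp [g]) (MvPolynomial.X (j.succAbove i))
        simp [g] at h
        simp [IsScalarTower.algebraMap_apply k (MvPolynomial (Fin 3) k) (Localization.Away _),
          l, g, h]
    exact Function.LeftInverse.injective (g := l.comp (algebraMap _ _)) fun p => congr($hl p)
  · intro z
    obtain ⟨n, p, hp, rfl⟩ := Away.mk_surjective (planeGrading k) (X_mem_planeGrading k j) z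
    refine ⟨MvPolynomial.aeval (j.insertNth 1 fun i => MvPolynomial.X i + MvPolynomial.C (a i)) p,
      val_injective _ ?_⟩
    let t : Submonoid.powers (MvPolynomial.X j : MvPolynomial (Fin 3) k) :=
      ⟨MvPolynomial.X j, Submonoid.mem_powers _⟩
    let y : Fin 3 → Localization.Away (MvPolynomial.X j : MvPolynomial (Fin 3) k) := fun i =>
      IsLocalization.mk' _ (MvPolynomial.X i) t
    have h := congr($(algebraMap_comp_chartCoordinates j a)
      (MvPolynomial.aeval (j.insertNth 1 fun i => MvPolynomial.X i + MvPolynomial.C (a i)) p))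
    have hy : (MvPolynomial.aeval (R := k) fun i => y (j.succAbove i) - algebraMap k _ (a i)).comp
        (MvPolynomial.aeval (j.insertNth 1 fun i => MvPolynomial.X i + MvPolynomial.C (a i))) =
        MvPolynomial.aeval y := by
      refine MvPolynomial.algHom_ext fun i => ?_
      obtain rfl | ⟨i, rfl⟩ := j.eq_self_or_eq_succAbove i
      · simp only [AlgHom.comp_apply, MvPolynomial.aeval_X, Fin.insertNth_apply_same, map_one]
        exact (IsLocalization.mk'_self _ _).symm
      · simp
    refine (h.trans congr($hy p)).trans ?_
    rw [Away.val_mk, Localization.mk_eq_mk', IsLocalization.eq_mk'_iff_mul_eq, map_pow, mul_comm]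
    rw [smul_eq_mul, mul_one] at hp
    rw [← aeval_mul_of_isHomogeneous hp]
    have hX : (fun i => algebraMap _ _ (MvPolynomial.X j) * y i) = fun i =>
        algebraMap _ _ (MvPolynomial.X i) :=
      funext fun i => IsLocalization.mk'_spec' _ (MvPolynomial.X i) t
    rw [hX]
    exact congr($((MvPolynomial.aeval_unique (IsScalarTower.toAlgHom k (MvPolynomial (Fin 3) k)
      (Localization.Away (MvPolynomial.X j : MvPolynomial (Fin 3) k)))).symm) p)

end Chart

end PlaneCurve

namespace PlaneCurve

attribute [local instance] MvPolynomial.gradedAlgebra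

/-! ### The generic point of the curve in homogeneous coordinates. -/

variable {C : Scheme.{0}} [C.Over (Spec (.of ℂ))] [LinearSeries.IsSmoothProjectiveCurve C]

theorem toSpecΓ_restrict_basicOpen {X : Scheme.{0}} (x : Γ(X, ⊤)) :
    (X.isoOfEq (X.toSpecΓ_preimage_basicOpen x)).inv ≫ X.toSpecΓ ∣_ _ ≫
      (basicOpenIsoSpecAway (R := Γ(X, ⊤)) x).hom ≫
        Spec.map (CommRingCat.ofHom (algebraMap Γ(X, ⊤) (Localization.Away x))) =
      (X.basicOpen x).ι ≫ X.toSpecΓ :=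
  calc
    _ = (X.isoOfEq (X.toSpecΓ_preimage_basicOpen x)).inv ≫ X.toSpecΓ ∣_ _ ≫
        Scheme.Opens.ι (X := Spec Γ(X, ⊤)) (PrimeSpectrum.basicOpen x) := by
      have h := basicOpenIsoSpecAway_hom_SpecMap (R := Γ(X, ⊤)) x
      congr 2
    _ = (X.isoOfEq (X.toSpecΓ_preimage_basicOpen x)).inv ≫
        (X.toSpecΓ ⁻¹ᵁ (PrimeSpectrum.basicOpen x)).ι ≫ X.toSpecΓ :=
      congrArg (_ ≫ ·) (morphismRestrict_ι X.toSpecΓ _)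
    _ = _ := X.isoOfEq_inv_ι_assoc _ _

/-- This makes the map to `Proj` computable on affine points: a ring map out of `A` localized at `t`
is determined on `A`, so the induced map on `Localization.Away t` must be `e`. -/
theorem toBasicOpenOfGlobalSections_eq {X : Scheme.{0}} {A : Type} [CommRing A] {σ : Type} [SetLike σ A]
    [AddSubgroupClass σ A]
    {𝒜 : ℕ → σ} [GradedRing 𝒜] (f : A →+* Γ(X, ⊤)) {t : A} {d : ℕ} (h0 : 0 < d) (hd : t ∈ 𝒜 d)
    {R : CommRingCat.{0}} (e : Localization.Away t →+* R) (g : Γ(X, ⊤) ⟶ R)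
    (p : Spec R ⟶ (X.basicOpen (f t)).toScheme)
    (hp : p ≫ (X.basicOpen (f t)).ι ≫ X.toSpecΓ = Spec.map g)
    (he : e.comp (algebraMap _ _) = g.hom.comp f) :
    p ≫ Proj.toBasicOpenOfGlobalSections 𝒜 f rfl h0 hd ≫ (Proj.basicOpen 𝒜 t).ι =
      Spec.map (CommRingCat.ofHom (e.comp (algebraMap (Away 𝒜 t) (Localization.Away t)))) ≫
        Proj.awayι 𝒜 t hd h0 := by
  let x := f t
  obtain ⟨g', hg'⟩ := Spec.map_surjective (p ≫ (X.isoOfEq (X.toSpecΓ_preimage_basicOpen x)).inv ≫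
    X.toSpecΓ ∣_ _ ≫ (basicOpenIsoSpecAway (R := Γ(X, ⊤)) x).hom)
  have hgg : CommRingCat.ofHom (algebraMap Γ(X, ⊤) (Localization.Away x)) ≫ g' = g := by
    apply Spec.map_injective
    rw [Spec.map_comp, hg', ← hp]
    exact congrArg (p ≫ ·) (toSpecΓ_restrict_basicOpen x)
  have hge : g'.hom.comp (IsLocalization.map (M := .powers t) (T := .powers x) (S := Localization.Away t)
      (Localization.Away x) f (by
        rw [← Submonoid.map_le_iff_le_comap, Submonoid.map_powers])) = e := by
    refine IsLocalization.ringHom_ext (Submonoid.powers t) ?_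
    rw [he, ← hgg, RingHom.comp_assoc, IsLocalization.map_comp]
    rfl
  rw [← hge, RingHom.comp_assoc, CommRingCat.ofHom_comp, CommRingCat.ofHom_hom, Spec.map_comp, hg',
    Proj.toBasicOpenOfGlobalSections]
  simp only [Category.assoc]
  rfl

theorem genericCoordinates_eq {s : Fin 3 → C.functionField} {j : Fin 3} (hj : s j ≠ 0)
    (hs : s ≠ 0) : LinearSeries.genericCoordinates s hs =
      Spec.map (CommRingCat.ofHom (evalAway (k := ℂ) hj)) ≫
        Proj.awayι (planeGrading ℂ) (MvPolynomial.X j) (X_mem_planeGrading ℂ j) one_pos := by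
  let K := C.functionField
  let f := LinearSeries.evalTriple s
  have hunit : IsUnit (f (MvPolynomial.X j)) := by
    refine IsUnit.map (Scheme.ΓSpecIso K).inv.hom ?_
    rw [AlgHom.toRingHom_eq_coe, RingHom.coe_coe, MvPolynomial.aeval_X]
    exact IsUnit.mk0 _ hj
  have htop : (Spec K).basicOpen (f (MvPolynomial.X j)) = ⊤ :=
    Scheme.basicOpen_of_isUnit _ hunit
  let p : Spec K ⟶ ((Spec K).basicOpen (f (MvPolynomial.X j))).toScheme :=
    (Scheme.topIso _).inv ≫ (Scheme.isoOfEq _ htop).inv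
  have hp : p ≫ Scheme.Opens.ι _ = 𝟙 _ := by simp [p]
  have hgl := Proj.fromOfGlobalSections_resLE (planeGrading ℂ) f
    (LinearSeries.map_irrelevant_evalTriple s hs) one_pos (X_mem_planeGrading ℂ j)
  have h1 := toBasicOpenOfGlobalSections_eq (𝒜 := planeGrading ℂ) f one_pos (X_mem_planeGrading ℂ j)
    (IsLocalization.Away.lift (S := Localization.Away (MvPolynomial.X j : MvPolynomial (Fin 3) ℂ))
      (MvPolynomial.X j) (g := (MvPolynomial.aeval (R := ℂ) s).toRingHom) (by simpa using hj))
    (Scheme.ΓSpecIso K).hom p (by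
      rw [reassoc_of% hp, SpecMap_ΓSpecIso_hom]) (by
      rw [IsLocalization.Away.lift_comp]
      exact RingHom.ext fun q => ((Scheme.ΓSpecIso K).inv_hom_id_apply _).symm)
  rw [← hgl] at h1
  refine Eq.trans ?_ h1
  rw [Scheme.Hom.resLE_comp_ι, reassoc_of% hp]
  rfl

/-- The point `[s₀ : s₁ : s₂]` factors through the local ring at `q`, so it specializes to `q` and
lies in every open set containing `q`. If `s j = 0`, it misses the chart `Xⱼ ≠ 0`. -/
theorem ne_zero_of_mem_basicOpen {s : Fin 3 → C.functionField} (hs : s ≠ 0) {q : LinearSeries.Plane}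
    {τ : LinearSeries.Plane.presheaf.stalk q ⟶ C.functionField}
    (hτ : Spec.map τ ≫ LinearSeries.Plane.fromSpecStalk q = LinearSeries.genericCoordinates s hs)
    {j : Fin 3} (hq : q ∈ Proj.basicOpen (planeGrading ℂ) (MvPolynomial.X j)) : s j ≠ 0 := by
  intro h0
  have h1 := Proj.fromOfGlobalSections_preimage_basicOpen (planeGrading ℂ)
    (LinearSeries.evalTriple s) (LinearSeries.map_irrelevant_evalTriple s hs) one_pos
    (X_mem_planeGrading ℂ j)
  have h2 : LinearSeries.evalTriple s (MvPolynomial.X j) = 0 := by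
    simp [LinearSeries.evalTriple, h0]
  rw [h2, Scheme.basicOpen_zero] at h1
  have h3 : IsLocalRing.closedPoint C.functionField ∈
      LinearSeries.genericCoordinates s hs ⁻¹ᵁ Proj.basicOpen (planeGrading ℂ) (MvPolynomial.X j) := by
    rw [← hτ]
    have : LinearSeries.Plane.fromSpecStalk q (Spec.map τ (IsLocalRing.closedPoint _)) ⤳ q := by
      have := Set.mem_range_self (f := LinearSeries.Plane.fromSpecStalk q)
        (Spec.map τ (IsLocalRing.closedPoint _))
      rwa [Scheme.range_fromSpecStalk] at this
    exact this.mem_open (Proj.basicOpen (planeGrading ℂ) (MvPolynomial.X j)).2 hq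
  exact (h1 ▸ h3 : _ ∈ (⊥ : (Spec C.functionField).Opens))

theorem SpecMap_awayToSection_awayι (k : Type) [Field k] (j : Fin 3) :
    Spec.map (Proj.awayToSection (planeGrading k) (MvPolynomial.X j)) ≫
        Proj.awayι (planeGrading k) (MvPolynomial.X j) (X_mem_planeGrading k j) one_pos =
      (Proj.isAffineOpen_basicOpen (planeGrading k) _ (X_mem_planeGrading k j) one_pos).fromSpec := by
  let hU := Proj.isAffineOpen_basicOpen (planeGrading k) _ (X_mem_planeGrading k j) one_pos
  rw [← cancel_epi hU.isoSpec.hom, IsAffineOpen.fromSpec, Iso.hom_inv_id_assoc, Proj.awayι,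
    ← Category.assoc, ← Category.assoc]
  have : hU.isoSpec.hom ≫ Spec.map (Proj.awayToSection (planeGrading k) (MvPolynomial.X j)) =
      (Proj.basicOpenIsoSpec (planeGrading k) _ (X_mem_planeGrading k j) one_pos).hom := by
    rw [Proj.basicOpenIsoSpec_hom, Proj.basicOpenToSpec]
    rfl
  rw [this, Iso.hom_inv_id, Category.id_comp]

theorem awayToSection_germ_comp {s : Fin 3 → C.functionField} (hs : s ≠ 0) {q : LinearSeries.Plane}
    {τ : LinearSeries.Plane.presheaf.stalk q ⟶ C.functionField}
    (hτ : Spec.map τ ≫ LinearSeries.Plane.fromSpecStalk q = LinearSeries.genericCoordinates s hs)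
    {j : Fin 3} (hq : q ∈ Proj.basicOpen (planeGrading ℂ) (MvPolynomial.X j)) (hj : s j ≠ 0) :
    Proj.awayToSection (planeGrading ℂ) (MvPolynomial.X j) ≫
      LinearSeries.Plane.presheaf.germ _ q hq ≫ τ = CommRingCat.ofHom (evalAway (k := ℂ) hj) := by
  let hU := Proj.isAffineOpen_basicOpen (planeGrading ℂ) _ (X_mem_planeGrading ℂ j) one_pos
  apply Spec.map_injective
  rw [← cancel_mono (Proj.awayι (planeGrading ℂ) (MvPolynomial.X j) (X_mem_planeGrading ℂ j) one_pos),
    ← genericCoordinates_eq hj hs, ← hτ]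
  simp only [Spec.map_comp, Category.assoc]
  rw [SpecMap_awayToSection_awayι]
  exact congrArg (Spec.map τ ≫ ·) (hU.fromSpecStalk_eq_fromSpecStalk hq)

end PlaneCurve

namespace PlaneCurve

attribute [local instance] MvPolynomial.gradedAlgebra

variable {C : Scheme.{0}} [C.Over (Spec (.of ℂ))] [LinearSeries.IsSmoothProjectiveCurve C]

/-! ### The map to the plane, its image and the local rings of the plane. -/

section PlaneMap

variable {s : Fin 3 → C.functionField} {hs : s ≠ 0} {φ : C ⟶ LinearSeries.Plane}

variable (C) in
theorem isDominant_fromSpecStalk_genericPoint : IsDominant (C.fromSpecStalk (genericPoint C)) := by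
  refine ⟨fun x => ?_⟩
  have h : genericPoint C ∈ Set.range (C.fromSpecStalk (genericPoint C)) := by
    rw [Scheme.range_fromSpecStalk]
    exact specializes_rfl
  have hx : x ∈ closure {genericPoint C} :=
    ((genericPoint_spec C).specializes trivial).mem_closure
  exact closure_mono (Set.singleton_subset_iff.2 h) hx

/-- `φ` is not assumed to be a morphism over `ℂ`. Compatibility with the structure morphisms is
checked at the dense generic point; then properness of `C` and separatedness of the plane give the
claim. -/
theorem universallyClosed_of_genericCoordinates
    (hφ : C.fromSpecStalk (genericPoint C) ≫ φ = LinearSeries.genericCoordinates s hs) :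
    UniversallyClosed φ := by
  let g : LinearSeries.Plane ⟶ Spec (.of ℂ) := Proj.toSpecZero (planeGrading ℂ) ≫
    Spec.map (CommRingCat.ofHom (algebraMap ℂ (planeGrading ℂ 0)))
  have : IsSeparated (Proj.toSpecZero (planeGrading ℂ)) := inferInstance
  have hg : φ ≫ g = C ↘ Spec (.of ℂ) := by
    have := isDominant_fromSpecStalk_genericPoint C
    refine ext_of_isDominant (C.fromSpecStalk (genericPoint C)) ?_
    rw [reassoc_of% hφ, fromSpecStalk_comp_over, LinearSeries.genericCoordinates,
      Proj.fromOfGlobalSections_toSpecZero_assoc, ← SpecMap_ΓSpecIso_hom, ← Spec.map_comp,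
      ← Spec.map_comp]
    congr 1
    ext c
    refine ((Scheme.ΓSpecIso C.functionField).inv_hom_id_apply _).trans ?_
    exact MvPolynomial.aeval_C s c
  have : UniversallyClosed (φ ≫ g) := hg ▸ inferInstance
  have : IsSeparated g := inferInstance
  exact .of_comp_of_isSeparated φ g

theorem quasiCompact_of_genericCoordinates
    (hφ : C.fromSpecStalk (genericPoint C) ≫ φ = LinearSeries.genericCoordinates s hs) :
    QuasiCompact φ := by
  have := universallyClosed_of_genericCoordinates hφ
  infer_instance

theorem toImage_surjective
    (hφ : C.fromSpecStalk (genericPoint C) ≫ φ = LinearSeries.genericCoordinates s hs) :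
    Function.Surjective φ.toImage := by
  have := universallyClosed_of_genericCoordinates hφ
  have : UniversallyClosed φ.toImage := inferInstance
  have : IsDominant φ.toImage := inferInstance
  rw [← Set.range_eq_univ, ← φ.toImage.isClosedMap.isClosed_range.closure_eq]
  exact φ.toImage.denseRange.closure_range

/-- Functions on the scheme-theoretic image inject into functions on `C`, and on an integral scheme
a germ determines the section. Hence the ideal of the image at `φ(x)` can be computed as a kernel
with values in `K(C)`. -/
theorem stalkMap_toImage_injective
    (hφ : C.fromSpecStalk (genericPoint C) ≫ φ = LinearSeries.genericCoordinates s hs)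
    (x : C) : Function.Injective (φ.toImage.stalkMap x) := by
  have := quasiCompact_of_genericCoordinates hφ
  obtain ⟨_, ⟨V, hV, rfl⟩, hxV, -⟩ :=
    LinearSeries.Plane.isBasis_affineOpens.exists_subset_of_mem_open
      (Set.mem_univ (φ x)) isOpen_univ
  have hU : IsAffineOpen (φ.imageι ⁻¹ᵁ V) := hV.preimage φ.imageι
  refine hU.stalkMap_injective φ.toImage x hxV fun g hg => ?_
  replace hg := (Scheme.Hom.germ_stalkMap_apply φ.toImage _ x hxV g).symm.trans hg
  have h0 := germ_injective_of_isIntegral _ x _ (hg.trans (map_zero _).symm)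
  rw [φ.toImage_app_injective ⟨V, hV⟩ (h0.trans (map_zero _).symm), map_zero]

theorem SpecMap_stalkMap_image (hφ : C.fromSpecStalk (genericPoint C) ≫ φ =
    LinearSeries.genericCoordinates s hs) (x : C) :
    Spec.map (φ.imageι.stalkMap (φ.toImage x) ≫ φ.toImage.stalkMap x ≫
        C.presheaf.stalkSpecializes ((genericPoint_spec C).specializes trivial)) ≫
      LinearSeries.Plane.fromSpecStalk (φ.imageι (φ.toImage x)) =
    LinearSeries.genericCoordinates s hs := by
  simp only [Spec.map_comp, Category.assoc]
  rw [Scheme.SpecMap_stalkMap_fromSpecStalk, Scheme.SpecMap_stalkMap_fromSpecStalk_assoc,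
    Scheme.SpecMap_stalkSpecializes_fromSpecStalk_assoc, Scheme.Hom.toImage_imageι, hφ]

theorem exists_mem_basicOpen_X (q : LinearSeries.Plane) :
    ∃ j, q ∈ Proj.basicOpen (planeGrading ℂ) (MvPolynomial.X j) := by
  have h := Proj.iSup_basicOpen_eq_top' (planeGrading ℂ) (MvPolynomial.X (R := ℂ))
    (fun i => ⟨1, X_mem_planeGrading ℂ i⟩) (by
      refine top_le_iff.1 fun p _ => ?_
      induction p using MvPolynomial.induction_on with
      | C c => exact Subalgebra.algebraMap_mem _ (algebraMap ℂ (planeGrading ℂ 0) c)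
      | add p q hp hq => exact add_mem (hp trivial) (hq trivial)
      | mul_X p i hp => exact mul_mem (hp trivial) (Algebra.subset_adjoin ⟨i, rfl⟩))
  exact TopologicalSpace.Opens.mem_iSup.1 (h.ge (Set.mem_univ q))

/-- The coordinates of the chart `Xⱼ ≠ 0`, as elements of the local ring of the plane at `q`. -/
noncomputable def stalkCoordinates {q : LinearSeries.Plane} {j : Fin 3}
    (hq : q ∈ Proj.basicOpen (planeGrading ℂ) (MvPolynomial.X j)) (a : Fin 2 → ℂ) :
    MvPolynomial (Fin 2) ℂ →+* LinearSeries.Plane.presheaf.stalk q :=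
  ((LinearSeries.Plane.presheaf.germ _ q hq).hom.comp
    (Proj.awayToSection (planeGrading ℂ) (MvPolynomial.X j)).hom).comp (chartCoordinates j a)

/-- The stalk is a localization of the coordinate ring of the chart, which `chartCoordinates`
identifies with the polynomial ring. -/
theorem isLocalization_stalkCoordinates {q : LinearSeries.Plane} {j : Fin 3}
    (hq : q ∈ Proj.basicOpen (planeGrading ℂ) (MvPolynomial.X j)) (a : Fin 2 → ℂ) :
    @IsLocalization.AtPrime _ _ (LinearSeries.Plane.presheaf.stalk q) _
      (stalkCoordinates hq a).toAlgebra
      ((IsLocalRing.maximalIdeal (LinearSeries.Plane.presheaf.stalk q)).comap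
        (stalkCoordinates hq a)) inferInstance := by
  let U := Proj.basicOpen (planeGrading ℂ) (MvPolynomial.X j)
  let hU : IsAffineOpen U :=
    Proj.isAffineOpen_basicOpen (planeGrading ℂ) _ (X_mem_planeGrading ℂ j) one_pos
  let := LinearSeries.Plane.presheaf.algebra_section_stalk ⟨q, hq⟩
  have hloc := hU.isLocalization_stalk ⟨q, hq⟩
  let e : MvPolynomial (Fin 2) ℂ →+* Γ(LinearSeries.Plane, U) :=
    (Proj.awayToSection (planeGrading ℂ) (MvPolynomial.X j)).hom.comp (chartCoordinates j a)
  have he : Function.Bijective e :=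
    (Proj.basicOpenIsoAway (planeGrading ℂ) _ (X_mem_planeGrading ℂ j)
      one_pos).commRingCatIsoToRingEquiv.bijective.comp (chartCoordinates_bijective j a)
  have key : ∀ p, stalkCoordinates hq a p =
      algebraMap Γ(LinearSeries.Plane, U) (LinearSeries.Plane.presheaf.stalk q) (e p) := fun _ => rfl
  have hmem : ∀ p, p ∈ ((IsLocalRing.maximalIdeal (LinearSeries.Plane.presheaf.stalk q)).comap
      (stalkCoordinates hq a)).primeCompl ↔ IsUnit (stalkCoordinates hq a p) := fun p => by
    simp [Ideal.primeCompl]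
  let S := (hU.primeIdealOf ⟨q, hq⟩).asIdeal.primeCompl
  have hS : ∀ {t' : MvPolynomial (Fin 2) ℂ} {t : S}, e t' = t → IsUnit (stalkCoordinates hq a t') := by
    intro t' t h
    rw [key, h]
    exact IsLocalization.map_units _ t
  let := (stalkCoordinates hq a).toAlgebra
  refine ⟨⟨fun p => (hmem _).1 p.2, fun z => ?_, fun {p r} h => ?_⟩⟩
  · obtain ⟨⟨b, t⟩, h⟩ := IsLocalization.surj S z
    obtain ⟨b, rfl⟩ := he.2 b
    obtain ⟨t', ht'⟩ := he.2 t
    refine ⟨⟨b, ⟨t', (hmem _).2 (hS ht')⟩⟩, ?_⟩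
    rw [← ht'] at h
    exact h
  · obtain ⟨c, hc⟩ := IsLocalization.exists_of_eq (M := S) (x := e p) (y := e r) h
    obtain ⟨c', hc'⟩ := he.2 c
    refine ⟨⟨c', (hmem _).2 (hS hc')⟩, he.1 ?_⟩
    rw [map_mul, map_mul, hc', hc]

theorem comp_stalkCoordinates {q : LinearSeries.Plane}
    {τ : LinearSeries.Plane.presheaf.stalk q ⟶ C.functionField}
    (hτ : Spec.map τ ≫ LinearSeries.Plane.fromSpecStalk q = LinearSeries.genericCoordinates s hs)
    {j : Fin 3} (hq : q ∈ Proj.basicOpen (planeGrading ℂ) (MvPolynomial.X j)) (hj : s j ≠ 0)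
    (a : Fin 2 → ℂ) :
    τ.hom.comp (stalkCoordinates hq a) =
      (MvPolynomial.aeval fun i => s (j.succAbove i) / s j - algebraMap ℂ _ (a i)).toRingHom := by
  rw [← evalAway_comp_chartCoordinates j a hj]
  have h := awayToSection_germ_comp hs hτ hq hj
  exact RingHom.ext fun p => congr($h (chartCoordinates j a p))

end PlaneMap
end PlaneCurve

namespace PlaneCurve

/-! ### Multiplicity in affine coordinates, and the meaning of birationality. -/

theorem mem_pow_of_mul_mem {R : Type*} [CommRing R] {M : Ideal R} [M.IsMaximal] {c f : R} {m : ℕ}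
    (hc : c ∉ M) (h : c * f ∈ M ^ m) : f ∈ M ^ m := by
  have hcop : IsCoprime (Ideal.span {c}) (M ^ m) := by
    refine IsCoprime.pow_right (Ideal.isCoprime_iff_sup_eq.2 ?_)
    rw [sup_comm]
    refine (‹M.IsMaximal›.out).2 _ (lt_of_le_of_ne le_sup_left fun h => hc ?_)
    exact h ▸ Ideal.mem_sup_right (Ideal.mem_span_singleton_self c)
  obtain ⟨r, hr, w, hw, hrw⟩ := Ideal.isCoprime_iff_exists.1 hcop
  obtain ⟨b, rfl⟩ := Ideal.mem_span_singleton'.1 hr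
  rw [← one_mul f, ← hrw, add_mul, mul_assoc]
  exact add_mem (Ideal.mul_mem_left _ _ h) (Ideal.mul_mem_right _ _ hw)

/-- The kernel is generated by `f` after localization, and powers of a maximal ideal contract to
themselves because elements outside `M` are invertible modulo `M ^ m`. -/
theorem ker_le_maximalIdeal_pow_iff {R O L : Type*} [CommRing R] [CommRing O] [IsLocalRing O]
    [CommRing L] [Algebra R O] (M : Ideal R) [M.IsMaximal] [IsLocalization.AtPrime O M]
    {τ : O →+* L} {f : R} (hf : RingHom.ker (τ.comp (algebraMap R O)) = Ideal.span {f}) (m : ℕ) :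
    RingHom.ker τ ≤ IsLocalRing.maximalIdeal O ^ m ↔ f ∈ M ^ m := by
  rw [← IsLocalization.AtPrime.map_eq_maximalIdeal M O, ← Ideal.map_pow]
  constructor
  · intro h
    have h0 : algebraMap R O f ∈ RingHom.ker τ :=
      hf.ge (Ideal.mem_span_singleton_self f)
    obtain ⟨⟨i, t⟩, hit⟩ := (IsLocalization.mem_map_algebraMap_iff M.primeCompl O).1 (h h0)
    rw [← map_mul] at hit
    obtain ⟨c, hc⟩ := IsLocalization.exists_of_eq (M := M.primeCompl) hit
    refine mem_pow_of_mul_mem (c := (c : R) * t) (M.primeCompl.mul_mem c.2 t.2) ?_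
    rw [mul_assoc, mul_comm (t : R), hc]
    exact Ideal.mul_mem_left _ _ i.2
  · intro h z hz
    obtain ⟨⟨p, t⟩, hpt⟩ := IsLocalization.surj M.primeCompl z
    have hp : p ∈ Ideal.span {f} := by
      rw [← hf, RingHom.mem_ker, RingHom.comp_apply, ← hpt, map_mul, (RingHom.mem_ker).1 hz, zero_mul]
    have hp' : algebraMap R O p ∈ Ideal.map (algebraMap R O) (M ^ m) :=
      Ideal.mem_map_of_mem _ ((Ideal.span_singleton_le_iff_mem _).2 h hp)
    rw [← hpt] at hp'
    exact (Ideal.mul_unit_mem_iff_mem _ (IsLocalization.map_units O t)).1 hp'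

theorem aeval_mem_adjoin_pair {k K : Type*} [Field k] [Field K] [Algebra k K] (u : Fin 2 → K)
    (p : MvPolynomial (Fin 2) k) :
    MvPolynomial.aeval u p ∈ IntermediateField.adjoin k {u 0, u 1} := by
  induction p using MvPolynomial.induction_on with
  | C c =>
    rw [MvPolynomial.aeval_C]
    exact IntermediateField.algebraMap_mem _ c
  | add p q hp hq =>
    rw [map_add]
    exact add_mem hp hq
  | mul_X p i hp =>
    rw [map_mul, MvPolynomial.aeval_X]
    refine mul_mem hp (IntermediateField.subset_adjoin _ _ ?_)
    fin_cases i <;> simp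

theorem adjoin_pair_eq_top_of_fractions {k K O : Type*} [Field k] [Field K] [Algebra k K]
    [CommRing O] {κ : MvPolynomial (Fin 2) k →+* O}
    (hκ : ∀ z, ∃ p t, z * κ t = κ p ∧ IsUnit (κ t)) {τ : O →+* K} (hτ : Function.Surjective τ)
    {u : Fin 2 → K} (hu : τ.comp κ = (MvPolynomial.aeval u).toRingHom) :
    IntermediateField.adjoin k {u 0, u 1} = ⊤ := by
  refine top_le_iff.1 fun h _ => ?_
  obtain ⟨z, rfl⟩ := hτ h
  obtain ⟨p, t, hpt, ht⟩ := hκ z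
  have hτ' : ∀ q, τ (κ q) = MvPolynomial.aeval u q := fun q => congr($hu q)
  have h0 := (ht.map τ).ne_zero
  have hz := congrArg τ hpt
  rw [map_mul, ← eq_div_iff h0, hτ', hτ'] at hz
  exact hz ▸ div_mem (aeval_mem_adjoin_pair u p) (aeval_mem_adjoin_pair u t)

attribute [local instance] MvPolynomial.gradedAlgebra

variable {C : Scheme.{0}} [C.Over (Spec (.of ℂ))] [LinearSeries.IsSmoothProjectiveCurve C]
  {s : Fin 3 → C.functionField} {hs : s ≠ 0} {φ : C ⟶ LinearSeries.Plane}

theorem isMaximal_idealOfVars (k : Type*) [Field k] : (MvPolynomial.idealOfVars (Fin 2) k).IsMaximal := by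
  have : MvPolynomial.idealOfVars (Fin 2) k = RingHom.ker (MvPolynomial.constantCoeff (R := k)) := by
    ext p
    rw [← pow_one (MvPolynomial.idealOfVars (Fin 2) k), MvPolynomial.mem_pow_idealOfVars_iff',
      RingHom.mem_ker, MvPolynomial.constantCoeff_eq]
    constructor
    · intro h
      exact h 0 (by simp)
    · intro h d hd
      rw [Nat.lt_one_iff, Finsupp.degree_eq_zero_iff] at hd
      rw [hd, h]
  rw [this]
  exact RingHom.ker_isMaximal_of_surjective _ fun c => ⟨MvPolynomial.C c, by simp⟩

/-- In coordinates centred at `φ(x)` the stalk of the plane is the polynomial ring localized at the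
origin. The ideal of the image is the kernel of evaluation in `K(C)`, generated by `f`, so the
multiplicity is the order of `f` at the origin. -/
theorem imageMultiplicity_toImage
    (hφ : C.fromSpecStalk (genericPoint C) ≫ φ = LinearSeries.genericCoordinates s hs)
    {x : C} {j : Fin 3} (hx : φ x ∈ Proj.basicOpen (planeGrading ℂ) (MvPolynomial.X j))
    {a : Fin 2 → ℂ}
    (ha : ∀ i, ∃ b ∈ IsLocalRing.maximalIdeal (C.presheaf.stalk x),
      algebraMap _ C.functionField b = s (j.succAbove i) / s j - algebraMap ℂ _ (a i))
    {f : MvPolynomial (Fin 2) ℂ} (hf0 : f ≠ 0)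
    (hf : RingHom.ker (MvPolynomial.aeval (R := ℂ)
      fun i => s (j.succAbove i) / s j - algebraMap ℂ C.functionField (a i)) = Ideal.span {f}) :
    LinearSeries.imageMultiplicity φ (φ.toImage x) = (radial ℂ f).natTrailingDegree := by
  have hx' : φ.imageι (φ.toImage x) ∈ Proj.basicOpen (planeGrading ℂ) (MvPolynomial.X j) := hx
  have hτ := SpecMap_stalkMap_image hφ x
  have hj := ne_zero_of_mem_basicOpen hs hτ hx'
  have hcomp := comp_stalkCoordinates hτ hx' hj a
  have hloc := isLocalization_stalkCoordinates hx' a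
  have hmax := isMaximal_idealOfVars ℂ
  have hinj : Function.Injective (φ.toImage.stalkMap x ≫
      C.presheaf.stalkSpecializes ((genericPoint_spec C).specializes trivial)) :=
    (IsFractionRing.injective (C.presheaf.stalk x) C.functionField).comp
      (stalkMap_toImage_injective hφ x)
  have hM : (IsLocalRing.maximalIdeal (LinearSeries.Plane.presheaf.stalk
      (φ.imageι (φ.toImage x)))).comap (stalkCoordinates hx' a) =
      MvPolynomial.idealOfVars (Fin 2) ℂ := by
    refine (hmax.eq_of_le (Ideal.IsPrime.ne_top inferInstance) ?_).symm
    rw [MvPolynomial.idealOfVars, Ideal.span_le]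
    rintro _ ⟨i, rfl⟩
    refine (IsLocalRing.mem_maximalIdeal _).2 fun hu => ?_
    obtain ⟨b, hb, hbe⟩ := ha i
    have hu' := hu.map (φ.imageι.stalkMap (φ.toImage x) ≫ φ.toImage.stalkMap x).hom
    refine (IsLocalRing.mem_maximalIdeal _).1 hb ?_
    convert hu'
    refine IsFractionRing.injective (C.presheaf.stalk x) C.functionField (hbe.trans ?_)
    have := congr($hcomp (MvPolynomial.X i))
    simp only [AlgHom.toRingHom_eq_coe, RingHom.coe_coe, MvPolynomial.aeval_X] at this
    exact this.symm
  let := (stalkCoordinates hx' a).toAlgebra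
  have hloc' : IsLocalization.AtPrime (LinearSeries.Plane.presheaf.stalk (φ.imageι (φ.toImage x)))
      (MvPolynomial.idealOfVars (Fin 2) ℂ) := by
    convert hloc using 2
    exact hM.symm
  rw [LinearSeries.imageMultiplicity, ← sSup_mem_pow_idealOfVars hf0]
  congr 1
  ext m
  simp only [Set.mem_ofPred_eq]
  rw [← ker_le_maximalIdeal_pow_iff (MvPolynomial.idealOfVars (Fin 2) ℂ)
    (τ := (φ.imageι.stalkMap (φ.toImage x) ≫ φ.toImage.stalkMap x ≫
        C.presheaf.stalkSpecializes ((genericPoint_spec C).specializes trivial)).hom) (f := f)]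
  · have hk : RingHom.ker (φ.imageι.stalkMap (φ.toImage x)).hom =
        RingHom.ker (φ.imageι.stalkMap (φ.toImage x) ≫ φ.toImage.stalkMap x ≫
          C.presheaf.stalkSpecializes ((genericPoint_spec C).specializes trivial)).hom := by
      ext z
      rw [RingHom.mem_ker, RingHom.mem_ker]
      exact (map_eq_zero_iff (φ.toImage.stalkMap x ≫
        C.presheaf.stalkSpecializes ((genericPoint_spec C).specializes trivial)).hom hinj).symm
    rw [hk]
  · exact (congrArg RingHom.ker hcomp).trans hf

theorem exists_coordinates_mem_maximalIdeal
    (hφ : C.fromSpecStalk (genericPoint C) ≫ φ = LinearSeries.genericCoordinates s hs)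
    {x : C} (hxc : IsClosed {x}) {j : Fin 3}
    (hx : φ x ∈ Proj.basicOpen (planeGrading ℂ) (MvPolynomial.X j)) :
    ∃ a : Fin 2 → ℂ, ∀ i, ∃ b ∈ IsLocalRing.maximalIdeal (C.presheaf.stalk x),
      algebraMap _ C.functionField b = s (j.succAbove i) / s j - algebraMap ℂ _ (a i) := by
  have hx' : φ.imageι (φ.toImage x) ∈ Proj.basicOpen (planeGrading ℂ) (MvPolynomial.X j) := hx
  have hτ := SpecMap_stalkMap_image hφ x
  have hj := ne_zero_of_mem_basicOpen hs hτ hx'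
  have hcomp := comp_stalkCoordinates hτ hx' hj 0
  have hr : ∀ i, ∃ r, algebraMap (C.presheaf.stalk x) C.functionField r = s (j.succAbove i) / s j := by
    intro i
    refine ⟨(φ.imageι.stalkMap (φ.toImage x) ≫ φ.toImage.stalkMap x).hom
      (stalkCoordinates hx' 0 (MvPolynomial.X i)), ?_⟩
    have := congr($hcomp (MvPolynomial.X i))
    simp only [AlgHom.toRingHom_eq_coe, RingHom.coe_coe, MvPolynomial.aeval_X, Pi.zero_apply,
      map_zero, sub_zero] at this
    exact this
  choose r hr using hr
  choose a ha using fun i => exists_sub_stalkScalar_mem hxc (r i)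
  refine ⟨a, fun i => ⟨_, ha i, ?_⟩⟩
  rw [map_sub, hr, algebraMap_stalkScalar]

/-- On a dense open set `f` is an open immersion, and that set contains the generic point. -/
theorem isIso_stalkMap_genericPoint {X Y : Scheme.{0}} [IsIntegral X] {f : X ⟶ Y}
    (hf : LinearSeries.IsBirationalMorphism f) : IsIso (f.stalkMap (genericPoint X)) := by
  obtain ⟨e, he⟩ := hf
  obtain ⟨W, hW, hWl, hWr, h⟩ := Scheme.PartialMap.toRationalMap_eq_iff.1 he
  have hη : genericPoint X ∈ W := by
    obtain ⟨y, hy⟩ := hW.nonempty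
    exact ((genericPoint_spec X).specializes trivial).mem_open W.2 hy
  have hWl' : W ≤ e.source := hWl
  have hWr' : W ≤ ⊤ := hWr
  have h' : X.homOfLE hWl' ≫ e.iso.hom ≫ e.target.ι = X.homOfLE hWr' ≫ (⊤ : X.Opens).ι ≫ f := by
    simp only [Scheme.PartialMap.restrict_hom, Scheme.PartialIso.toPartialMap_hom,
      Scheme.Hom.toPartialMap_hom] at h
    exact h
  rw [Scheme.homOfLE_ι_assoc] at h'
  have ho : IsOpenImmersion (W.ι ≫ f) := by
    rw [← h']
    infer_instance
  let w : W.toScheme := ⟨genericPoint X, hη⟩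
  have h1 : IsIso ((W.ι ≫ f).stalkMap w) := inferInstance
  have h2 : IsIso (f.stalkMap (W.ι w) ≫ W.ι.stalkMap w) := by
    rw [← Scheme.Hom.stalkMap_comp]
    exact h1
  exact IsIso.of_isIso_comp_right (f.stalkMap (W.ι w)) (W.ι.stalkMap w)

theorem exists_mul_stalkCoordinates {q : LinearSeries.Plane} {j : Fin 3}
    (hq : q ∈ Proj.basicOpen (planeGrading ℂ) (MvPolynomial.X j)) (a : Fin 2 → ℂ)
    (z : LinearSeries.Plane.presheaf.stalk q) :
    ∃ p t, z * stalkCoordinates hq a t = stalkCoordinates hq a p ∧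
      IsUnit (stalkCoordinates hq a t) := by
  let := (stalkCoordinates hq a).toAlgebra
  have := isLocalization_stalkCoordinates hq a
  obtain ⟨⟨p, t⟩, hpt⟩ := IsLocalization.surj ((IsLocalRing.maximalIdeal
    (LinearSeries.Plane.presheaf.stalk q)).comap (stalkCoordinates hq a)).primeCompl z
  exact ⟨p, t, hpt, IsLocalization.map_units _ t⟩

/-- By birationality the stalk of the plane at the image of the generic point maps onto `K(C)`, and
its elements are fractions of polynomials in the two coordinates. -/
theorem adjoin_coordinates_eq_top
    (hφ : C.fromSpecStalk (genericPoint C) ≫ φ = LinearSeries.genericCoordinates s hs)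
    (hbir : LinearSeries.IsBirationalMorphism φ.toImage) {x : C} {j : Fin 3}
    (hx : φ x ∈ Proj.basicOpen (planeGrading ℂ) (MvPolynomial.X j)) (a : Fin 2 → ℂ) :
    IntermediateField.adjoin ℂ {s (j.succAbove 0) / s j - algebraMap ℂ C.functionField (a 0),
      s (j.succAbove 1) / s j - algebraMap ℂ C.functionField (a 1)} = ⊤ := by
  have hx' : φ.imageι (φ.toImage (genericPoint C)) ∈ Proj.basicOpen (planeGrading ℂ) (MvPolynomial.X j) :=
    ((genericPoint_spec C).specializes trivial).mem_open
      (φ ⁻¹ᵁ (Proj.basicOpen (planeGrading ℂ) (MvPolynomial.X j))).2 hx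
  have hτ := SpecMap_stalkMap_image hφ (genericPoint C)
  have hj := ne_zero_of_mem_basicOpen hs hτ hx'
  have hcomp := comp_stalkCoordinates hτ hx' hj a
  have hiso := isIso_stalkMap_genericPoint hbir
  have hsurj : Function.Surjective (φ.imageι.stalkMap (φ.toImage (genericPoint C)) ≫
      φ.toImage.stalkMap (genericPoint C) ≫
      C.presheaf.stalkSpecializes ((genericPoint_spec C).specializes trivial)).hom := by
    have h1 : Function.Surjective (φ.toImage.stalkMap (genericPoint C)) :=
      (ConcreteCategory.bijective_of_isIso _).2
    have h2 : Function.Surjective (C.presheaf.stalkSpecializes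
        ((genericPoint_spec C).specializes trivial : genericPoint C ⤳ genericPoint C)) := by
      rw [TopCat.Presheaf.stalkSpecializes_refl]
      exact fun y => ⟨y, rfl⟩
    exact (h2.comp h1).comp (φ.imageι.stalkMap_surjective _)
  have key := adjoin_pair_eq_top_of_fractions (k := ℂ) (K := C.functionField)
    (u := fun i => s (j.succAbove i) / s j - algebraMap ℂ C.functionField (a i))
    (κ := stalkCoordinates hx' a) (exists_mul_stalkCoordinates hx' a) hsurj hcomp
  exact key

end PlaneCurve

namespace PlaneCurve

/-! ### Line bundles generated by pencils, and their degrees. -/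

section Valuation

variable {k K : Type*} [Field k] [Field K] [Algebra k K] {A : ValuationSubring K}

theorem valuation_smul_le (hA : ∀ c : k, algebraMap k K c ∈ A) (c : k) (f : K) :
    A.valuation (c • f) ≤ A.valuation f := by
  rw [Algebra.smul_def, map_mul]
  exact mul_le_of_le_one_left' ((A.valuation_le_one_iff _).2 (hA c))

theorem valuation_le_of_mem_span (hA : ∀ c : k, algebraMap k K c ∈ A) {S : Set K} {w f : K}
    (hS : ∀ g ∈ S, A.valuation g ≤ A.valuation w) (hf : f ∈ Submodule.span k S) :
    A.valuation f ≤ A.valuation w := by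
  induction hf using Submodule.span_induction with
  | mem f hf => exact hS f hf
  | zero => simp
  | add f g _ _ hf hg => exact (A.valuation.map_add f g).trans (max_le hf hg)
  | smul c f _ hf => exact (valuation_smul_le hA c f).trans hf

/-- Reduction modulo the maximal ideal of `A`: if `u` reduces to `a`, then `p(u)` reduces to `p(a)`.
-/
theorem valuation_aeval_sub_lt_one (hA : ∀ c : k, algebraMap k K c ∈ A) {σ : Type*} {u : σ → K}
    {a : σ → k} (hu : ∀ i, A.valuation (u i - algebraMap k K (a i)) < 1) (p : MvPolynomial σ k) :
    A.valuation (MvPolynomial.aeval u p - algebraMap k K (MvPolynomial.eval a p)) < 1 := by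
  have hle : ∀ c, A.valuation (algebraMap k K c) ≤ 1 := fun c =>
    (A.valuation_le_one_iff _).2 (hA c)
  induction p using MvPolynomial.induction_on with
  | C c => simp
  | add p q hp hq =>
    rw [map_add, map_add, map_add, add_sub_add_comm]
    exact A.valuation.map_add_lt hp hq
  | mul_X p i hp =>
    have h1 : A.valuation (MvPolynomial.aeval u p) ≤ 1 := by
      rw [← sub_add_cancel (MvPolynomial.aeval u p) (algebraMap k K (MvPolynomial.eval a p))]
      exact A.valuation.map_add_le hp.le (hle _)
    have h2 : MvPolynomial.aeval u (p * MvPolynomial.X i) -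
        algebraMap k K (MvPolynomial.eval a (p * MvPolynomial.X i)) =
        MvPolynomial.aeval u p * (u i - algebraMap k K (a i)) +
          algebraMap k K (a i) *
            (MvPolynomial.aeval u p - algebraMap k K (MvPolynomial.eval a p)) := by
      simp only [map_mul, MvPolynomial.aeval_X, MvPolynomial.eval_X]
      ring
    rw [h2]
    refine A.valuation.map_add_lt ?_ ?_ <;> rw [map_mul]
    · exact mul_lt_one_of_nonneg_of_lt_one_right h1 zero_le (hu i)
    · exact mul_lt_one_of_nonneg_of_lt_one_right (hle _) zero_le hp

/-- An algebraic quotient would be a constant, as `k` is algebraically closed, hence a linear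
relation. -/
theorem transcendental_div_of_linearIndependent [IsAlgClosed k] {f g : K}
    (h : LinearIndependent k ![f, g]) : Transcendental k (g / f) := by
  intro hfg
  obtain ⟨c, hc⟩ := IsPlaceSystem.exists_algebraMap_eq_of_isAlgebraic hfg
  have hf : f ≠ 0 := h.ne_zero 0
  rw [eq_div_iff hf, ← Algebra.smul_def] at hc
  have := (LinearIndependent.pair_iff.1 h c (-1) (by simp [hc])).2
  simp at this

end Valuation

section Triple

variable {k K : Type*} [Field k] [AddCommGroup K] [Module k K] {f g h : K}

theorem linearIndependent_triple_iff : LinearIndependent k ![f, g, h] ↔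
    ∀ a b c : k, a • f + b • g + c • h = 0 → a = 0 ∧ b = 0 ∧ c = 0 := by
  rw [Fintype.linearIndependent_iff]
  constructor
  · intro H a b c habc
    have := H ![a, b, c] (by simpa [Fin.sum_univ_three] using habc)
    exact ⟨this 0, this 1, this 2⟩
  · intro H a ha i
    obtain ⟨h0, h1, h2⟩ := H (a 0) (a 1) (a 2) (by simpa [Fin.sum_univ_three] using ha)
    fin_cases i
    exacts [h0, h1, h2]

theorem linearIndependent_triple_sub (H : LinearIndependent k ![f, g, h]) (a b : k) :
    LinearIndependent k ![f - a • h, g - b • h, h] := by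
  rw [linearIndependent_triple_iff] at H ⊢
  intro x y z hxyz
  obtain ⟨rfl, rfl, hz⟩ := H x y (z - x * a - y * b) (by rw [← hxyz]; module)
  exact ⟨rfl, rfl, by simpa using hz⟩

theorem span_triple_sub (a b : k) :
    Submodule.span k {f - a • h, g - b • h, h} = Submodule.span k {f, g, h} := by
  apply le_antisymm <;> intro w hw <;> rw [Submodule.mem_span_triple] at hw ⊢ <;>
    obtain ⟨x, y, z, rfl⟩ := hw
  · exact ⟨x, y, z - x * a - y * b, by module⟩
  · exact ⟨x, y, z + x * a + y * b, by module⟩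

theorem linearIndependent_pair_of_triple (H : LinearIndependent k ![f, g, h]) :
    LinearIndependent k ![f, g] := by
  rw [linearIndependent_triple_iff] at H
  refine LinearIndependent.pair_iff.2 fun x y hxy => ?_
  obtain ⟨hx, hy, -⟩ := H x y 0 (by simpa using hxy)
  exact ⟨hx, hy⟩

theorem notMem_span_pair_of_triple (H : LinearIndependent k ![f, g, h]) :
    h ∉ Submodule.span k {f, g} := by
  rw [linearIndependent_triple_iff] at H
  intro hh
  obtain ⟨x, y, hxy⟩ := Submodule.mem_span_pair.1 hh
  exact neg_ne_zero.2 one_ne_zero (H x y (-1) (by rw [hxy]; simp)).2.2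

theorem linearIndependent_triple_succAbove {s : Fin 3 → K} (hs : LinearIndependent k s)
    (j : Fin 3) : LinearIndependent k ![s (j.succAbove 0), s (j.succAbove 1), s j] := by
  rw [linearIndependent_triple_iff]
  intro x y z hxyz
  have := Fintype.linearIndependent_iff.1 hs (j.insertNth z ![x, y]) (by
    rw [Fin.sum_univ_succAbove _ j, Fin.sum_univ_two]
    simp only [Fin.insertNth_apply_same, Fin.insertNth_apply_succAbove]
    rw [← hxyz]
    simp only [Matrix.cons_val_zero, Matrix.cons_val_one]
    abel)
  exact ⟨by simpa using this (j.succAbove 0), by simpa using this (j.succAbove 1),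
    by simpa using this j⟩

theorem span_triple_succAbove (s : Fin 3 → K) (j : Fin 3) :
    Submodule.span k {s (j.succAbove 0), s (j.succAbove 1), s j} =
      Submodule.span k (Set.range s) := by
  congr 1
  ext w
  fin_cases j <;> simp [Fin.exists_fin_succ, Fin.succAbove] <;> tauto

theorem finrank_span_pair_of_triple (H : LinearIndependent k ![f, g, h]) :
    Module.finrank k (Submodule.span k {f, g}) = 2 := by
  have := finrank_span_eq_card (linearIndependent_pair_of_triple H)
  rwa [Matrix.range_cons_cons_empty, Fintype.card_fin] at this

theorem span_pair_lt_of_triple (H : LinearIndependent k ![f, g, h]) :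
    Submodule.span k {f, g} < Submodule.span k {f, g, h} := by
  refine lt_of_le_of_ne (Submodule.span_mono (by grind)) fun he => ?_
  exact notMem_span_pair_of_triple H (he ▸ Submodule.subset_span (by simp))

end Triple

variable {C : Scheme.{0}} [C.Over (Spec (.of ℂ))] [LinearSeries.IsSmoothProjectiveCurve C]
  {W : Submodule ℂ C.functionField} {D D' : LinearSeries.Divisor C}

theorem valuation_le_iff {x : {x : C // IsClosed {x}}} {f g : C.functionField} (hf : f ≠ 0)
    (hg : g ≠ 0) :
    (placeRing x).valuation f ≤ (placeRing x).valuation g ↔ C.ord g x.1 ≤ C.ord f x.1 := by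
  have H := isPlaceSystem_placeRing C
  have h1 := H.ord_div x hf hg
  have h2 := H.ord_nonneg_iff x (div_ne_zero hf hg)
  rw [← div_le_one₀ (by simpa [zero_lt_iff] using hg), ← map_div₀,
    (placeRing x).valuation_le_one_iff, ← h2, h1, sub_nonneg]

theorem span_stalk_eq {x : {x : C // IsClosed {x}}} {w : C.functionField} (hw : w ∈ W) (hw0 : w ≠ 0)
    (h : ∀ v ∈ W, (placeRing x).valuation v ≤ (placeRing x).valuation w) :
    (Submodule.span (C.presheaf.stalk x.1) (W : Set C.functionField) : Set C.functionField) =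
      {f | (placeRing x).valuation f ≤ (placeRing x).valuation w} := by
  have hpos : 0 < (placeRing x).valuation w := by simpa [zero_lt_iff] using hw0
  ext f
  rw [SetLike.mem_coe, Set.mem_ofPred_eq]
  constructor
  · intro hf
    induction hf using Submodule.span_induction with
    | mem f hf => exact h f hf
    | zero => simp
    | add f g _ _ hf hg => exact ((placeRing x).valuation.map_add f g).trans (max_le hf hg)
    | smul a f _ hf =>
      rw [Algebra.smul_def, map_mul]
      exact (mul_le_of_le_one_left' (((placeRing x).valuation_le_one_iff _).2 ⟨a, rfl⟩)).trans hf
  · intro hf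
    rw [← div_le_one₀ hpos, ← map_div₀, (placeRing x).valuation_le_one_iff] at hf
    obtain ⟨a, ha⟩ := hf
    rw [eq_div_iff hw0, ← Algebra.smul_def] at ha
    exact ha ▸ Submodule.smul_mem _ a (Submodule.subset_span hw)

theorem mem_lineBundleStalk_iff {x : {x : C // IsClosed {x}}} {w f : C.functionField} (hw0 : w ≠ 0)
    (h : C.ord w x.1 = -D x) : f ∈ LinearSeries.lineBundleStalk D x ↔
      (placeRing x).valuation f ≤ (placeRing x).valuation w := by
  rw [LinearSeries.lineBundleStalk, Set.mem_ofPred_eq]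
  by_cases hf : f = 0
  · simp [hf]
  · rw [valuation_le_iff hf hw0, h]
    simp only [hf, false_or]
    omega

/-- A space of rational functions generates `𝒪_C(D)` if and only if its largest valuation at
each closed point `x` is attained by an element of order `-D x`. -/
theorem generates_iff : LinearSeries.Generates W D ↔ ∀ x : {x : C // IsClosed {x}},
    ∃ w ∈ W, w ≠ 0 ∧ C.ord w x.1 = -D x ∧
      ∀ v ∈ W, (placeRing x).valuation v ≤ (placeRing x).valuation w := by
  refine forall_congr' fun x => ⟨fun h => ?_, fun ⟨w, hw, hw0, hord, hv⟩ => ?_⟩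
  · have H := isPlaceSystem_placeRing C
    -- The power `t ^ (-D x)` generates the stalk of `𝒪_C(D)` at `x`.
    obtain ⟨t, ht0, ht⟩ := exists_ord_eq_one x.2
    have hz := H.ord_zpow x ht0 (-D x)
    simp only [ht, mul_one] at hz
    have ht0' := zpow_ne_zero (-D x) ht0
    have hsub : ∀ v ∈ W, (placeRing x).valuation v ≤ (placeRing x).valuation (t ^ (-D x)) :=
      fun v hv => (mem_lineBundleStalk_iff ht0' hz).1 (h.le (Submodule.subset_span hv))
    by_cases hex : ∃ w ∈ W, (placeRing x).valuation w = (placeRing x).valuation (t ^ (-D x))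
    · obtain ⟨w, hw, hwt⟩ := hex
      have hw0 : w ≠ 0 := by
        rintro rfl
        rw [map_zero] at hwt
        exact ht0' ((map_eq_zero _).1 hwt.symm)
      refine ⟨w, hw, hw0, ?_, fun v hv => hwt ▸ hsub v hv⟩
      have h1 := (valuation_le_iff hw0 ht0').1 hwt.le
      have h2 := (valuation_le_iff ht0' hw0).1 hwt.ge
      omega
    -- If no member of `W` attained this valuation, the whole span over the stalk would stay
    -- strictly below it and miss the generator.
    · push Not at hex
      have hmem : t ^ (-D x) ∈ Submodule.span (C.presheaf.stalk x.1) (W : Set C.functionField) :=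
        h.ge ((mem_lineBundleStalk_iff ht0' hz).2 le_rfl)
      have hlt : ∀ f ∈ Submodule.span (C.presheaf.stalk x.1) (W : Set C.functionField),
          (placeRing x).valuation f < (placeRing x).valuation (t ^ (-D x)) := by
        intro f hf
        induction hf using Submodule.span_induction with
        | mem f hf => exact lt_of_le_of_ne (hsub f hf) (hex f hf)
        | zero =>
          rw [map_zero, zero_lt_iff]
          exact (map_ne_zero _).2 ht0'
        | add f g _ _ hf hg => exact (placeRing x).valuation.map_add_lt hf hg
        | smul a f _ hf =>
          rw [Algebra.smul_def, map_mul]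
          exact (mul_le_of_le_one_left'
            (((placeRing x).valuation_le_one_iff _).2 ⟨a, rfl⟩)).trans_lt hf
      exact absurd (hlt _ hmem) (lt_irrefl _)
  · rw [span_stalk_eq hw hw0 hv]
    ext f
    exact (mem_lineBundleStalk_iff hw0 hord).symm

theorem eq_of_generates (h : LinearSeries.Generates W D) (h' : LinearSeries.Generates W D') :
    D = D' := by
  ext x
  obtain ⟨w, hw, hw0, hord, hv⟩ := generates_iff.1 h x
  obtain ⟨w', hw', hw0', hord', hv'⟩ := generates_iff.1 h' x
  have h1 := (valuation_le_iff hw0 hw0').1 (hv' w hw)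
  have h2 := (valuation_le_iff hw0' hw0).1 (hv w' hw')
  omega

theorem generates_span_pair_iff {f g : C.functionField} (hf : f ≠ 0) (hg : g ≠ 0) :
    LinearSeries.Generates (Submodule.span ℂ {f, g}) D ↔
      ∀ x, D x = -min (C.ord f x.1) (C.ord g x.1) := by
  rw [generates_iff]
  refine forall_congr' fun x => ?_
  have hmax : ∃ w ∈ Submodule.span ℂ {f, g}, w ≠ 0 ∧
      C.ord w x.1 = min (C.ord f x.1) (C.ord g x.1) ∧
      ∀ v ∈ Submodule.span ℂ {f, g}, (placeRing x).valuation v ≤ (placeRing x).valuation w := by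
    rcases le_total (C.ord f x.1) (C.ord g x.1) with h | h
    · refine ⟨f, Submodule.subset_span (by simp), hf, (min_eq_left h).symm, fun v hv => ?_⟩
      refine valuation_le_of_mem_span (algebraMap_mem_placeRing x) ?_ hv
      rintro _ (rfl | rfl)
      exacts [le_rfl, (valuation_le_iff hg hf).2 h]
    · refine ⟨g, Submodule.subset_span (by simp), hg, (min_eq_right h).symm, fun v hv => ?_⟩
      refine valuation_le_of_mem_span (algebraMap_mem_placeRing x) ?_ hv
      rintro _ (rfl | rfl)
      exacts [(valuation_le_iff hf hg).2 h, le_rfl]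
  obtain ⟨w', hw', hw0', hord', hv'⟩ := hmax
  constructor
  · rintro ⟨w, hw, hw0, hord, hv⟩
    have h1 := (valuation_le_iff hw0 hw0').1 (hv' w hw)
    have h2 := (valuation_le_iff hw0' hw0).1 (hv w' hw')
    omega
  · exact fun h => ⟨w', hw', hw0', by omega, hv'⟩

theorem exists_generates_span_pair {f g : C.functionField} (H : LinearIndependent ℂ ![f, g]) :
    ∃ D : LinearSeries.Divisor C, LinearSeries.Generates (Submodule.span ℂ {f, g}) D ∧
      D.degree = Module.finrank (IntermediateField.adjoin ℂ {g / f}) C.functionField := by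
  have hf : f ≠ 0 := H.ne_zero 0
  have hg : g ≠ 0 := H.ne_zero 1
  obtain ⟨hfin, hsum⟩ := (isPlaceSystem_placeRing C).finsum_neg_min_ord
    (fun _ => finiteDimensional_functionField) hg hf (transcendental_div_of_linearIndependent H)
  refine ⟨Finsupp.ofSupportFinite _ hfin, (generates_span_pair_iff hf hg).2 fun x => ?_, ?_⟩
  · rw [Finsupp.ofSupportFinite_coe, min_comm]
  · rw [← hsum]
    exact (finsum_eq_sum_of_support_subset _
      (Finsupp.fun_support_eq (Finsupp.ofSupportFinite _ hfin)).le).symm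

theorem degree_eq_finrank {f g : C.functionField} (H : LinearIndependent ℂ ![f, g])
    (h : LinearSeries.Generates (Submodule.span ℂ {f, g}) D) :
    D.degree = Module.finrank (IntermediateField.adjoin ℂ {g / f}) C.functionField := by
  obtain ⟨D', hD', hdeg⟩ := exists_generates_span_pair H
  rw [eq_of_generates h hD', hdeg]

end PlaneCurve

namespace PlaneCurve

attribute [local instance] MvPolynomial.gradedAlgebra

/-! ### Pencils of lines and linear stability. -/

variable {C : Scheme.{0}} [C.Over (Spec (.of ℂ))] [LinearSeries.IsSmoothProjectiveCurve C]
  {D D' : LinearSeries.Divisor C}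

/-- The pencil of lines through a point off a plane curve has no base points on the curve. -/
theorem generates_span_pair_of_eval_ne_zero {f g h : C.functionField} (hh : h ≠ 0)
    {p : MvPolynomial (Fin 2) ℂ} (hp : MvPolynomial.aeval ![f / h, g / h] p = 0) {a : Fin 2 → ℂ}
    (ha : MvPolynomial.eval a p ≠ 0)
    (hD : LinearSeries.Generates (Submodule.span ℂ {f, g, h}) D) :
    LinearSeries.Generates (Submodule.span ℂ {f - a 0 • h, g - a 1 • h}) D := by
  refine generates_iff.2 fun x => ?_
  obtain ⟨w, hw, hw0, hord, hv⟩ := generates_iff.1 hD x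
  let ν := (placeRing x).valuation
  have hA := algebraMap_mem_placeRing x
  have hle : Submodule.span ℂ {f - a 0 • h, g - a 1 • h} ≤ Submodule.span ℂ {f, g, h} := by
    rw [← span_triple_sub (a 0) (a 1)]
    exact Submodule.span_mono (by grind)
  suffices hex : ∃ w' ∈ ({f - a 0 • h, g - a 1 • h} : Set C.functionField), ν w' = ν w by
    obtain ⟨w', hw', hww'⟩ := hex
    have hw0' : w' ≠ 0 := by
      rintro rfl
      rw [map_zero] at hww'
      exact hw0 ((map_eq_zero _).1 hww'.symm)
    refine ⟨w', Submodule.subset_span hw', hw0', ?_, fun v hv' => hww' ▸ hv v (hle hv')⟩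
    have h1 := (valuation_le_iff hw0 hw0').1 hww'.ge
    have h2 := (valuation_le_iff hw0' hw0).1 hww'.le
    omega
  by_contra! hex
  have hlt : ∀ w' ∈ ({f - a 0 • h, g - a 1 • h} : Set C.functionField), ν w' < ν w :=
    fun w' hw' => lt_of_le_of_ne (hv w' (hle (Submodule.subset_span hw'))) (hex w' hw')
  have hf := hlt (f - a 0 • h) (by simp)
  have hg := hlt (g - a 1 • h) (by simp)
  -- If both generators of the pencil vanish at `x` relative to `w`, then `h` cannot. So `(f / h, g
  -- / h)` reduces to `a` at `x`, and the relation `p` forces `p(a) = 0`.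
  have hhw : ν w ≤ ν h := by
    by_contra! hhw
    rw [← span_triple_sub (a 0) (a 1), Submodule.mem_span_triple] at hw
    obtain ⟨α, β, γ, hw⟩ := hw
    have : ν w < ν w := by
      nth_rw 1 [← hw]
      exact ν.map_add_lt (ν.map_add_lt ((valuation_smul_le hA _ _).trans_lt hf)
        ((valuation_smul_le hA _ _).trans_lt hg)) ((valuation_smul_le hA _ _).trans_lt hhw)
    exact lt_irrefl _ this
  have hpos : 0 < ν h := zero_lt_iff.2 ((map_ne_zero _).2 hh)
  have hu : ∀ i, ν (![f / h, g / h] i - algebraMap ℂ C.functionField (a i)) < 1 := by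
    have aux : ∀ (e : C.functionField) (c : ℂ), ν (e - c • h) < ν w →
        ν (e / h - algebraMap ℂ C.functionField c) < 1 := by
      intro e c he
      rw [← mul_div_cancel_right₀ (algebraMap ℂ C.functionField c) hh, ← sub_div, map_div₀,
        div_lt_one₀ hpos, ← Algebra.smul_def]
      exact he.trans_le hhw
    intro i
    fin_cases i
    exacts [aux _ _ hf, aux _ _ hg]
  have hlt1 := valuation_aeval_sub_lt_one hA hu p
  rw [hp, zero_sub, Valuation.map_neg, ← not_le, ← inv_le_one₀, ← map_inv₀, ← map_inv₀] at hlt1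
  · exact hlt1 (((placeRing x).valuation_le_one_iff _).2 (hA _))
  · exact zero_lt_iff.2 ((map_ne_zero _).2 ((map_ne_zero _).2 ha))

theorem div_sub_algebraMap {k K : Type*} [Field k] [Field K] [Algebra k K] {h : K} (hh : h ≠ 0)
    (f : K) (c : k) : f / h - algebraMap k K c = (f - c • h) / h := by
  rw [Algebra.smul_def, sub_div, mul_div_cancel_right₀ _ hh]

/-- Project from a point `a` off the curve: the pencil of lines through `a` generates all of
`𝒪_C(D)`, and the degree of the projection is the degree of the equation. -/
theorem degree_eq_natDegree_radial {f g h : C.functionField} (H : LinearIndependent ℂ ![f, g, h])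
    {p : MvPolynomial (Fin 2) ℂ} (hp0 : p ≠ 0)
    (hp : RingHom.ker (MvPolynomial.aeval (R := ℂ) ![f / h, g / h]) = Ideal.span {p})
    (hK : IntermediateField.adjoin ℂ {f / h, g / h} = ⊤)
    (hD : LinearSeries.Generates (Submodule.span ℂ {f, g, h}) D) :
    D.degree = (radial ℂ p).natDegree := by
  obtain ⟨a, ha⟩ := exists_eval_ne_zero hp0
  have hh : h ≠ 0 := H.ne_zero 2
  have H' := linearIndependent_pair_of_triple (linearIndependent_triple_sub H (a 0) (a 1))
  have hf : f - a 0 • h ≠ 0 := H'.ne_zero 0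
  have hdiv : (g / h - algebraMap ℂ C.functionField (a 1)) /
      (f / h - algebraMap ℂ C.functionField (a 0)) = (g - a 1 • h) / (f - a 0 • h) := by
    rw [div_sub_algebraMap hh, div_sub_algebraMap hh, div_div_div_cancel_right₀ hh]
  have hp' : MvPolynomial.aeval ![f / h, g / h] p = 0 :=
    RingHom.mem_ker.1 (hp.ge (Ideal.mem_span_singleton_self p))
  rw [degree_eq_finrank H' (generates_span_pair_of_eval_ne_zero hh hp' ha hD),
    ← finrank_adjoin_slope_of_eval_ne_zero (u := f / h) (v := g / h) (a := a) ?_ ?_ hK hp ha, hdiv]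
  · rw [div_sub_algebraMap hh]
    exact div_ne_zero hf hh
  · rw [hdiv]
    exact transcendental_div_of_linearIndependent H'

/-- Project from the origin of the chart: the degree drops from that of the equation by its order
there. -/
theorem exists_generates_degree_add_eq {f g h : C.functionField}
    (H : LinearIndependent ℂ ![f, g, h]) {p : MvPolynomial (Fin 2) ℂ} (hp0 : p ≠ 0)
    (hp : RingHom.ker (MvPolynomial.aeval (R := ℂ) ![f / h, g / h]) = Ideal.span {p})
    (hK : IntermediateField.adjoin ℂ {f / h, g / h} = ⊤)
    (hD : LinearSeries.Generates (Submodule.span ℂ {f, g, h}) D) :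
    ∃ D' : LinearSeries.Divisor C, LinearSeries.Generates (Submodule.span ℂ {f, g}) D' ∧
      D'.degree + (radial ℂ p).natTrailingDegree = D.degree := by
  have hh : h ≠ 0 := H.ne_zero 2
  have H' := linearIndependent_pair_of_triple H
  have hf : f ≠ 0 := H'.ne_zero 0
  obtain ⟨D', hD', hdeg⟩ := exists_generates_span_pair H'
  have hdiv : g / h / (f / h) = g / f := div_div_div_cancel_right₀ hh _ _
  refine ⟨D', hD', ?_⟩
  have := finrank_adjoin_slope (div_ne_zero hf hh)
    (hdiv ▸ transcendental_div_of_linearIndependent H') hK hp0 hp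
  rw [hdiv] at this
  rw [degree_eq_natDegree_radial H hp0 hp hK hD, hdeg, ← this, Nat.cast_add]

/-- A pencil in the series spanned by `f, g, h` that has a base point at `x`, where `h` does not
vanish and `f, g` do, is the pencil spanned by `f` and `g`. -/
theorem eq_span_pair_of_divisor_ne {f g h : C.functionField} (H : LinearIndependent ℂ ![f, g, h])
    {x : {x : C // IsClosed {x}}}
    (hf : (placeRing x).valuation f < (placeRing x).valuation h)
    (hg : (placeRing x).valuation g < (placeRing x).valuation h)
    (hD : LinearSeries.Generates (Submodule.span ℂ {f, g, h}) D)
    {W : Submodule ℂ C.functionField} (hWV : W ≤ Submodule.span ℂ {f, g, h})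
    (hW : Module.finrank ℂ W = 2) (hD' : LinearSeries.Generates W D') (hne : D' x ≠ D x) :
    W = Submodule.span ℂ {f, g} := by
  have hA := algebraMap_mem_placeRing x
  have hh : h ≠ 0 := H.ne_zero 2
  obtain ⟨w, hw, hw0, hord, hv⟩ := generates_iff.1 hD x
  obtain ⟨w', hw', hw0', hord', hv'⟩ := generates_iff.1 hD' x
  have hmax : ∀ v ∈ Submodule.span ℂ {f, g, h},
      (placeRing x).valuation v ≤ (placeRing x).valuation h := fun v hv => by
    refine valuation_le_of_mem_span hA ?_ hv
    rintro _ (rfl | rfl | rfl)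
    exacts [hf.le, hg.le, le_rfl]
  have hwh : C.ord h x.1 = C.ord w x.1 := le_antisymm
    ((valuation_le_iff hw0 hh).1 (hmax w hw))
    ((valuation_le_iff hh hw0).1 (hv h (Submodule.subset_span (by simp))))
  -- As `D'` and `D` differ at `x`, no member of `W` attains the valuation of `h`. A member with
  -- nonzero coefficient on `h` would attain it.
  have hlt : (placeRing x).valuation w' < (placeRing x).valuation h := by
    refine lt_of_le_of_ne (hmax w' (hWV hw')) fun he => hne ?_
    have h1 := (valuation_le_iff hw0' hh).1 he.le
    have h2 := (valuation_le_iff hh hw0').1 he.ge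
    omega
  have : FiniteDimensional ℂ (Submodule.span ℂ {f, g}) :=
    .of_finrank_pos (by rw [finrank_span_pair_of_triple H]; exact two_pos)
  refine Submodule.eq_of_le_of_finrank_eq (fun e he => ?_)
    (hW.trans (finrank_span_pair_of_triple H).symm)
  obtain ⟨α, β, γ, rfl⟩ := Submodule.mem_span_triple.1 (hWV he)
  by_cases hγ : γ = 0
  · exact Submodule.mem_span_pair.2 ⟨α, β, by simp [hγ]⟩
  exfalso
  have hγh : h = γ⁻¹ • ((α • f + β • g + γ • h) - (α • f + β • g)) := by
    rw [add_sub_cancel_left, inv_smul_smul₀ hγ]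
  have : (placeRing x).valuation h < (placeRing x).valuation h := by
    nth_rw 1 [hγh]
    refine (valuation_smul_le hA _ _).trans_lt (Valuation.map_sub_lt _ ((hv' _ he).trans_lt hlt) ?_)
    exact Valuation.map_add_lt _ ((valuation_smul_le hA _ _).trans_lt hf)
      ((valuation_smul_le hA _ _).trans_lt hg)
  exact lt_irrefl _ this

theorem valuation_lt_one_of_mem_maximalIdeal {x : {x : C // IsClosed {x}}}
    {b : C.presheaf.stalk x.1} (hb : b ∈ IsLocalRing.maximalIdeal (C.presheaf.stalk x.1)) :
    (placeRing x).valuation (algebraMap _ C.functionField b) < 1 := by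
  refine lt_of_le_of_ne (((placeRing x).valuation_le_one_iff _).2 ⟨b, rfl⟩) fun he => ?_
  have hinv : (algebraMap (C.presheaf.stalk x.1) C.functionField b)⁻¹ ∈ placeRing x := by
    rw [← (placeRing x).valuation_le_one_iff, map_inv₀, he, inv_one]
  obtain ⟨c, hc⟩ := hinv
  have hb0 : algebraMap (C.presheaf.stalk x.1) C.functionField b ≠ 0 := by
    intro h0
    rw [h0, map_zero] at he
    exact zero_ne_one he
  have hbc : b * c = 1 := by
    apply IsFractionRing.injective (C.presheaf.stalk x.1) C.functionField
    rw [map_mul, hc, map_one, mul_inv_cancel₀ hb0]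
  exact (IsLocalRing.mem_maximalIdeal _).1 hb (.of_mul_eq_one c hbc)

variable {V : Submodule ℂ C.functionField} {b : Module.Basis (Fin 3) ℂ V}
  {φ : C ⟶ LinearSeries.Plane}

/-- The pencil of lines through the image of a closed point. -/
theorem exists_pencil (hgen : LinearSeries.Generates V D) (hφ : LinearSeries.IsMapOfSeries b φ)
    (hbir : LinearSeries.IsBirationalMorphism φ.toImage) (x : {x : C // IsClosed {x}}) :
    ∃ (W : Submodule ℂ C.functionField) (D₀ : LinearSeries.Divisor C),
      W < V ∧ Module.finrank ℂ W = 2 ∧ LinearSeries.Generates W D₀ ∧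
      D₀.degree + LinearSeries.imageMultiplicity φ (φ.toImage x.1) = D.degree ∧
      ∀ W' ≤ V, Module.finrank ℂ W' = 2 → ∀ D', LinearSeries.Generates W' D' → D' x ≠ D x →
        W' = W := by
  obtain ⟨j, hj⟩ := exists_mem_basicOpen_X (φ x.1)
  obtain ⟨a, ha⟩ := exists_coordinates_mem_maximalIdeal hφ x.2 hj
  let s : Fin 3 → C.functionField := fun i => (b i : C.functionField)
  have hs : LinearIndependent ℂ s := b.linearIndependent.map' V.subtype V.ker_subtype
  have hsV : Submodule.span ℂ (Set.range s) = V := by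
    have := congrArg (Submodule.map V.subtype) b.span_eq
    rw [Submodule.map_span, ← Set.range_comp, Submodule.map_top, Submodule.range_subtype] at this
    exact this
  -- With `a` the coordinates of `φ(x)` in the chart, `f` and `g` are the lines through `φ(x)`
  -- parallel to the axes.
  let f := s (j.succAbove 0) - a 0 • s j
  let g := s (j.succAbove 1) - a 1 • s j
  have H : LinearIndependent ℂ ![f, g, s j] :=
    linearIndependent_triple_sub (linearIndependent_triple_succAbove hs j) _ _
  have hV : Submodule.span ℂ {f, g, s j} = V := by
    rw [← hsV, ← span_triple_succAbove s j]
    exact span_triple_sub _ _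
  have hh : s j ≠ 0 := H.ne_zero 2
  have hf' : s (j.succAbove 0) / s j - algebraMap ℂ C.functionField (a 0) = f / s j :=
    div_sub_algebraMap hh _ _
  have hg' : s (j.succAbove 1) / s j - algebraMap ℂ C.functionField (a 1) = g / s j :=
    div_sub_algebraMap hh _ _
  have hcoord : (fun i => s (j.succAbove i) / s j - algebraMap ℂ C.functionField (a i)) =
      ![f / s j, g / s j] := by
    funext i
    fin_cases i
    exacts [hf', hg']
  have hK : IntermediateField.adjoin ℂ {f / s j, g / s j} = ⊤ := by
    rw [← hf', ← hg']
    exact adjoin_coordinates_eq_top hφ hbir hj a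
  have Hfh : LinearIndependent ℂ ![s j, f] := by
    refine LinearIndependent.pair_iff.2 fun y z hyz => ?_
    obtain ⟨hz, -, hy⟩ := linearIndependent_triple_iff.1 H z 0 y (by rw [← hyz]; module)
    exact ⟨hy, hz⟩
  obtain ⟨p, hp0, hp⟩ := exists_ker_aeval_eq_span
    (not_algebraicIndependent_of_trdeg_le_one (trdeg_functionField_le_one C) ![f / s j, g / s j])
    (transcendental_div_of_linearIndependent Hfh)
  have hmul : LinearSeries.imageMultiplicity φ (φ.toImage x.1) =
      (radial ℂ p).natTrailingDegree := by
    refine imageMultiplicity_toImage hφ hj ha hp0 ?_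
    rw [← hp, ← hcoord]
  rw [← hV] at hgen
  obtain ⟨D₀, hD₀, hdeg⟩ := exists_generates_degree_add_eq H hp0 hp hK hgen
  have hlt : ∀ (e : C.functionField) (c : ℂ), (∃ b ∈ IsLocalRing.maximalIdeal
      (C.presheaf.stalk x.1), algebraMap _ C.functionField b =
        e / s j - algebraMap ℂ C.functionField c) →
      (placeRing x).valuation (e - c • s j) < (placeRing x).valuation (s j) := by
    rintro e c ⟨r, hr, hre⟩
    have := valuation_lt_one_of_mem_maximalIdeal hr
    rwa [hre, div_sub_algebraMap hh, map_div₀,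
      div_lt_one₀ (zero_lt_iff.2 ((map_ne_zero _).2 hh))] at this
  refine ⟨Submodule.span ℂ {f, g}, D₀, hV ▸ span_pair_lt_of_triple H,
    finrank_span_pair_of_triple H, hD₀, hmul ▸ hdeg, fun W' hW' hr D' hD' hne => ?_⟩
  exact eq_span_pair_of_divisor_ne H (hlt _ _ (ha 0)) (hlt _ _ (ha 1)) hgen (hV ▸ hW') hr hD' hne

theorem isClosed_toImage (hφ : LinearSeries.IsMapOfSeries b φ) {x : C} (hx : IsClosed {x}) :
    IsClosed {φ.toImage x} := by
  have := universallyClosed_of_genericCoordinates hφ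
  have : UniversallyClosed φ.toImage := inferInstance
  rw [← Set.image_singleton]
  exact φ.toImage.isClosedMap _ hx

theorem exists_toImage_eq (hφ : LinearSeries.IsMapOfSeries b φ) {p : φ.image}
    (hp : IsClosed {p}) : ∃ x, IsClosed {x} ∧ φ.toImage x = p := by
  have := compactSpace_curve C
  obtain ⟨x, hx, hxc⟩ := (hp.preimage φ.toImage.continuous).exists_closed_singleton
    (toImage_surjective hφ p)
  exact ⟨x, hxc, hx⟩

variable (C) in
theorem exists_isClosed_singleton : ∃ x : C, IsClosed {x} := by
  have := compactSpace_curve C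
  obtain ⟨x, -, hx⟩ := isClosed_univ.exists_closed_singleton
    (S := (Set.univ : Set C)) ⟨genericPoint C, trivial⟩
  exact ⟨x, hx⟩

theorem finrank_eq_two {W : Submodule ℂ C.functionField} (b : Module.Basis (Fin 3) ℂ V)
    (hWV : W < V) (hW : 2 ≤ Module.finrank ℂ W) : Module.finrank ℂ W = 2 := by
  have : FiniteDimensional ℂ V := b.finiteDimensional_of_finite
  have h1 := Submodule.finrank_lt_finrank_of_lt hWV
  have h2 := Module.finrank_eq_card_basis b
  rw [Fintype.card_fin] at h2
  omega

/-- Every pencil in the series generates either `𝒪_C(D)` or the moving part of the pencil of lines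
through a closed point of the image, whose degree is `deg D` minus the multiplicity there. -/
theorem degree_cases (hgen : LinearSeries.Generates V D) (hφ : LinearSeries.IsMapOfSeries b φ)
    (hbir : LinearSeries.IsBirationalMorphism φ.toImage) {W : Submodule ℂ C.functionField}
    (hWV : W < V) (hW : Module.finrank ℂ W = 2) (hD' : LinearSeries.Generates W D') :
    D'.degree = D.degree ∨ ∃ p : φ.image, IsClosed {p} ∧
      D'.degree + LinearSeries.imageMultiplicity φ p = D.degree := by
  by_cases hDD : D' = D
  · exact .inl (congrArg _ hDD)
  obtain ⟨x, hx⟩ := DFunLike.ne_iff.1 hDD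
  obtain ⟨W₀, D₀, -, -, hD₀, hdeg, huniq⟩ := exists_pencil hgen hφ hbir x
  have hWW := huniq W hWV.le hW D' hD' hx
  subst hWW
  exact .inr ⟨φ.toImage x.1, isClosed_toImage hφ x.2, eq_of_generates hD' hD₀ ▸ hdeg⟩

/-- A property of the degrees of the pencils in the series is a property of the multiplicities
of the image. -/
theorem forall_degree_iff (hgen : LinearSeries.Generates V D)
    (hφ : LinearSeries.IsMapOfSeries b φ) (hbir : LinearSeries.IsBirationalMorphism φ.toImage)
    {P : ℤ → Prop} (hP : ∀ m : ℕ, P (D.degree - m) → P D.degree) :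
    (∀ W : Submodule ℂ C.functionField, W < V → 2 ≤ Module.finrank ℂ W →
      ∀ D' : LinearSeries.Divisor C, LinearSeries.Generates W D' → P D'.degree) ↔
    ∀ p : φ.image, IsClosed {p} → P (D.degree - LinearSeries.imageMultiplicity φ p) := by
  constructor
  · intro h p hp
    obtain ⟨x, hx, rfl⟩ := exists_toImage_eq hφ hp
    obtain ⟨W, D₀, hWV, hW, hD₀, hdeg, -⟩ := exists_pencil hgen hφ hbir ⟨x, hx⟩
    rw [← hdeg, add_sub_cancel_right]
    exact h W hWV hW.ge D₀ hD₀
  · intro h W hWV hW D' hD'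
    rcases degree_cases hgen hφ hbir hWV (finrank_eq_two b hWV hW) hD' with hdeg | ⟨p, hp, hdeg⟩
    -- A pencil without base points: the hypothesis at any closed point of the image suffices, by
    -- `hP`.
    · obtain ⟨x, hx⟩ := exists_isClosed_singleton C
      rw [hdeg]
      exact hP _ (h _ (isClosed_toImage hφ hx))
    · have := h p hp
      rwa [← hdeg, add_sub_cancel_right] at this

end PlaneCurve

theorem mainTheorem3
    (C : Scheme.{0}) [C.Over (Spec (.of ℂ))] [LinearSeries.IsSmoothProjectiveCurve C]
    (D : LinearSeries.Divisor C) (V : Submodule ℂ C.functionField)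
    (hV : (V : Set C.functionField) ⊆ LinearSeries.globalSections D)
    (hrk : LinearSeries.rk V = 2)
    (hgen : LinearSeries.Generates V D)
    (b : Module.Basis (Fin 3) ℂ V)
    (φ : C ⟶ LinearSeries.Plane) (hφ : LinearSeries.IsMapOfSeries b φ)
    (hbir : LinearSeries.IsBirationalMorphism φ.toImage) :
    (LinearSeries.IsLinearlyStable D V ↔
      ∀ p : φ.image, IsClosed {p} →
        (LinearSeries.imageMultiplicity φ p : ℚ) < (D.degree : ℚ) / 2) ∧
    (LinearSeries.IsLinearlySemistable D V ↔
      ∀ p : φ.image, IsClosed {p} →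
        (LinearSeries.imageMultiplicity φ p : ℚ) ≤ (D.degree : ℚ) / 2) := by
  -- With ranks `1` and `2` both conditions concern only `deg D'` against `deg D / 2`, and `d - m >
  -- d / 2` is the same as `m < d / 2`.
  have hrkW : ∀ W : Submodule ℂ C.functionField, W < V → 2 ≤ Module.finrank ℂ W →
      LinearSeries.rk W = 1 := fun W hWV hW => by
    rw [LinearSeries.rk, PlaneCurve.finrank_eq_two b hWV hW]
    norm_num
  constructor
  · rw [LinearSeries.IsLinearlyStable]
    have key := PlaneCurve.forall_degree_iff hgen hφ hbir
      (P := fun d => (d : ℚ) > (D.degree : ℚ) / 2) fun m hm => by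
        push_cast at hm
        have := m.cast_nonneg (α := ℚ)
        linarith
    refine Iff.trans ?_ (key.trans ?_)
    · refine forall₃_congr fun W hWV hW => forall₂_congr fun D' _ => ?_
      rw [hrkW W hWV hW, hrk]
      norm_num
    · refine forall₂_congr fun p _ => ?_
      push_cast
      constructor <;> intro h <;> linarith
  · rw [LinearSeries.IsLinearlySemistable]
    have key := PlaneCurve.forall_degree_iff hgen hφ hbir
      (P := fun d => (d : ℚ) ≥ (D.degree : ℚ) / 2) fun m hm => by
        push_cast at hm
        have := m.cast_nonneg (α := ℚ)
        linarith
    refine Iff.trans ?_ (key.trans ?_)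
    · refine forall₃_congr fun W hWV hW => forall₂_congr fun D' _ => ?_
      rw [hrkW W hWV hW, hrk]
      norm_num
    · refine forall₂_congr fun p _ => ?_
      push_cast
      constructor <;> intro h <;> linarith
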